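/- Let $F\in\mathbb{R}[x,y,z]$ be irreducible and let $S=\{F=0\}\subset\mathbb{R}^3$. Assume that $S$ contains a regular smooth surface patch on which the Gaussian curvature does not vanish identically. Consider the three one-parameter groups $$Q_t=\begin{pmatrix}\cos t&-\sin t&0\\ \sin t&\cos t&0\\0&0&1\end{pmatrix},\quad \begin{pmatrix}\cosh t&\sinh t&0\\ \sinh t&\cosh t&0\\0&0&1\end{pmatrix},\quad \begin{pmatrix}1&0&0\\ t&1&0\\ t^2/2&t&1\end{pmatrix},$$ and assume that $S$ is an affine rotation surface about a line $\mathcal{A}$: there is an invertible affine map $T$ of $\mathbb{R}^3$ (for instance a rigid motion) taking the $z$-axis to $\mathcal{A}$ such that $T^{-1}(S)$ is invariant under one of these groups. Let $(\beta,\alpha)$ be Plücker coordinates of $\mathcal{A}$, i.e. $\alpha\neq 0$ is a direction vector of $\mathcal{A}$ and $\beta=Q\times\alpha$ with $Q\in\mathcal{A}$. For a regular parametrized surface $\mathbf{x}(u,v)$ with unit normal $\mathbf{N}$ and Gaussian curvature $K\neq 0$, put $\nu=|K|^{-1/4}\mathbf{N}$; its affine normal vector is $\xi=[\nu,\nu_u,\nu_v]^{-1}(\nu_u\times\nu_v)$,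 where $[\cdot,\cdot,\cdot]$ is the determinant. A triple $\gamma=(\gamma_1,\gamma_2,\gamma_3)$ of rational functions in $\mathbb{R}(x,y,z)$ is called a rational part of the affine normal of $F$ if, for $P$ in some nonempty Zariski open subset of $\mathbb{R}^3$, $\gamma$ is defined at $P$ and, whenever the level surface $\{F=F(P)\}$ has nonzero Gaussian curvature at $P$, its affine normal vector at $P$ (for any local regular parametrization) is a real multiple $a\,\gamma(P)$ of $\gamma(P)$. Then such a $\gamma$ exists, and for every such $\gamma$, with $P=(x,y,z)$, $$\alpha\cdot(P\times\gamma)+\beta\cdot\gamma=0$$ identically in $\mathbb{R}(x,y,z)$; in particular, every point $P\in\mathbb{R}^3$ at which $\gamma$ is defined, on $S$ or not, gives a homogeneous linear equation $\alpha\cdot(P\times\gamma(P))+\beta\cdot\gamma(P)=0$ satisfied by the Plücker coordinates $(\beta,\alpha)$ of every such axis. -/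

import Mathlib

open scoped Matrix ContDiff

noncomputable section

namespace AffineRotation

/-- Real 3-space, with coordinates `x = p 0`, `y = p 1`, `z = p 2`. -/
abbrev R3 : Type := Fin 3 → ℝ

/-- Polynomials in `x, y, z` with real coefficients. -/
abbrev Poly : Type := MvPolynomial (Fin 3) ℝ

/-- Rational functions of `x, y, z` with real coefficients. -/
abbrev RatFun : Type := FractionRing Poly

/-- The real surface `F(x, y, z) = 0`. -/
def zeroSet (F : Poly) : Set R3 := {P | MvPolynomial.eval P F = 0}

/-- The rational function `r` is defined at the point `P`, where it takes the value `c`: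
`r` is a quotient of polynomials whose denominator does not vanish at `P`. -/
def HasValueAt (r : RatFun) (P : R3) (c : ℝ) : Prop :=
  ∃ p q : Poly, MvPolynomial.eval P q ≠ 0 ∧
    r = algebraMap Poly RatFun p / algebraMap Poly RatFun q ∧
    c = MvPolynomial.eval P p / MvPolynomial.eval P q

section Lines

/-- The `z`-axis. -/
def zAxis : AffineSubspace ℝ R3 := AffineSubspace.mk' 0 (Submodule.span ℝ {![0, 0, 1]})

/-- `(β, α)` are Plücker coordinates of the line `A`: the vector `α` is a nonzero direction vector
of `A`, and `β = Q × α` for a point `Q` of `A`. -/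
def IsPluckerCoordinates (A : AffineSubspace ℝ R3) (β α : R3) : Prop :=
  α ≠ 0 ∧ ∃ Q : R3, A = AffineSubspace.mk' Q (Submodule.span ℝ {α}) ∧ β = Q ⨯₃ α

end Lines

section Rotations

/-- The three types of affine rotations. -/
inductive RotationType : Type
  | elliptic
  | hyperbolic
  | parabolic

/-- The three canonical one-parameter groups of affine rotations about the `z`-axis. -/
def rotationMatrix : RotationType → ℝ → Matrix (Fin 3) (Fin 3) ℝ
  | .elliptic, t => !![Real.cos t, -Real.sin t, 0; Real.sin t, Real.cos t, 0; 0, 0, 1]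
  | .hyperbolic, t => !![Real.cosh t, Real.sinh t, 0; Real.sinh t, Real.cosh t, 0; 0, 0, 1]
  | .parabolic, t => !![1, 0, 0; t, 1, 0; t ^ 2 / 2, t, 1]

/-- `S` is an affine rotation surface about the line `A`: in a suitable coordinate system in which
`A` is the `z`-axis, `S` is invariant under one of the three canonical one-parameter groups. Every
affine coordinate system is admitted, in particular every rectangular (orthonormal) one. -/
def IsAffineRotationSurface (S : Set R3) (A : AffineSubspace ℝ R3) : Prop :=
  ∃ (T : R3 ≃ᵃ[ℝ] R3) (τ : RotationType),
    zAxis.map (T : R3 →ᵃ[ℝ] R3) = A ∧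
    ∀ (t : ℝ) (p : R3), T (rotationMatrix τ t *ᵥ p) ∈ S ↔ T p ∈ S

end Rotations

section DifferentialGeometry

/-- Partial derivative with respect to the first parameter `u`. -/
def dU (f : ℝ × ℝ → R3) (q : ℝ × ℝ) : R3 := fderiv ℝ f q (1, 0)

/-- Partial derivative with respect to the second parameter `v`. -/
def dV (f : ℝ × ℝ → R3) (q : ℝ × ℝ) : R3 := fderiv ℝ f q (0, 1)

/-- `x` restricted to the open set `U` is a smooth regular parametrized surface. -/
structure IsRegularPatch (x : ℝ × ℝ → R3) (U : Set (ℝ × ℝ)) : Prop where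
  isOpen : IsOpen U
  contDiffOn : ContDiffOn ℝ ∞ x U
  regular : ∀ q ∈ U, dU x q ⨯₃ dV x q ≠ 0

/-- The unit Euclidean normal vector `N`. -/
def unitNormal (x : ℝ × ℝ → R3) (q : ℝ × ℝ) : R3 :=
  (Real.sqrt ((dU x q ⨯₃ dV x q) ⬝ᵥ (dU x q ⨯₃ dV x q)))⁻¹ • (dU x q ⨯₃ dV x q)

/-- The Gaussian curvature: the determinant of the second fundamental form over the determinant of
the first one. -/
def gaussCurvature (x : ℝ × ℝ → R3) (q : ℝ × ℝ) : ℝ :=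
  ((unitNormal x q ⬝ᵥ dU (dU x) q) * (unitNormal x q ⬝ᵥ dV (dV x) q)
      - (unitNormal x q ⬝ᵥ dV (dU x) q) ^ 2) /
    ((dU x q ⬝ᵥ dU x q) * (dV x q ⬝ᵥ dV x q) - (dU x q ⬝ᵥ dV x q) ^ 2)

/-- The affine co-normal vector `ν = |K|^(-1/4) N`. -/
def conormal (x : ℝ × ℝ → R3) (q : ℝ × ℝ) : R3 :=
  |gaussCurvature x q| ^ (-(1 / 4) : ℝ) • unitNormal x q

/-- The affine normal vector `ξ = [ν, ν_u, ν_v]⁻¹ (ν_u × ν_v)`. -/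
def affineNormal (x : ℝ × ℝ → R3) (q : ℝ × ℝ) : R3 :=
  (Matrix.det ![conormal x q, dU (conormal x) q, dV (conormal x) q])⁻¹ •
    (dU (conormal x) q ⨯₃ dV (conormal x) q)

/-- `S` contains a regular surface patch (so that its real part is two-dimensional) on which the
Gaussian curvature does not vanish identically. -/
def HasNonzeroCurvature (S : Set R3) : Prop :=
  ∃ (x : ℝ × ℝ → R3) (U : Set (ℝ × ℝ)), IsRegularPatch x U ∧ (∀ q ∈ U, x q ∈ S) ∧
    ∃ q ∈ U, gaussCurvature x q ≠ 0

/-- The triple `γ` of rational functions is the rational part of the affine normal of `F`: at every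
point `P` of a nonempty Zariski open set, `γ` is defined, and the affine normal at `P` of the level
surface of `F` through `P`, where the Gaussian curvature of that surface is nonzero, is a real
multiple `a γ(P)` of `γ(P)`, whatever regular parametrization of the level surface is used. -/
def IsRationalPartOfAffineNormal (F : Poly) (γ : Fin 3 → RatFun) : Prop :=
  ∃ h : Poly, h ≠ 0 ∧ ∀ P : R3, MvPolynomial.eval P h ≠ 0 →
    ∃ c : R3, (∀ i, HasValueAt (γ i) P (c i)) ∧
      ∀ (x : ℝ × ℝ → R3) (U : Set (ℝ × ℝ)), IsRegularPatch x U →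
        (∀ q ∈ U, MvPolynomial.eval (x q) F = MvPolynomial.eval P F) →
        ∀ q ∈ U, x q = P → gaussCurvature x q ≠ 0 →
          ∃ a : ℝ, affineNormal x q = a • c

end DifferentialGeometry

/-- A real constant vector, as a vector of rational functions. -/
def constVec (v : R3) : Fin 3 → RatFun := fun i => algebraMap ℝ RatFun (v i)

/-- The generic point `(x, y, z)`, as a vector of rational functions. -/
def genericPoint : Fin 3 → RatFun := fun i => algebraMap Poly RatFun (MvPolynomial.X i)

end AffineRotation

end

/-!
The affine normal of a level surface of `F` is described by a polynomial vector field. Let `g` and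
`H` be the gradient and the Hessian of `F`, and `D = gᵀ adj(H) g` (`curvPoly`). A level surface of
`F` has Gaussian curvature `D / |g|⁴`, so that its co-normal is `± |D|^(-1/4) g`
(`gaussCurvature_eq`, `conormal_eq`). Differentiating this, one finds that the derivatives of the
co-normal along tangent vectors `w` are proportional to `M w`, where `M = 4 D H - g (∇D)ᵀ`; hence
the affine normal is proportional to `N = adj(M)ᵀ g` (`normalPoly`, `exists_affineNormal_eq`), and
`N` is a rational part of the affine normal. As there is a smooth level surface through every point
where `g ≠ 0`, any other rational part is generically proportional to `N`.

In coordinates where the axis is the `z`-axis, let `B` be the generator of the group of rotations.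
The vector field `X` of the rotations about the axis is affine, with linear part `A` conjugate to
`B`. It is tangent to `S`, so `X F` vanishes on `S`. Since `S` contains a two-dimensional patch, the
irreducible `F` divides `X F` (`IsRegularPatch.dvd_of_vanish`, by elimination of a variable), and as
`X F` has no larger degree, `X F = k F` with a constant `k`. Then `F` is multiplied by `exp (k t)`
along the orbits. This forces `k = 0`: elliptic orbits are periodic, on parabolic orbits `F` is a
polynomial in `t`, and for hyperbolic rotations `k ≠ 0` would make `F` vanish on a plane, which has
no curvature (`axisField_eq_zero`).

From `X F = 0` one gets `X D = 0` (as `tr A = 0`) and `H X = -Aᵀ g`. Since `M X = -4 D Aᵀ g` and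
`N · M X = det M (g · X) = 0`, the vector `A N` is orthogonal to `g`, and so is `X` itself. Both lie
in the image of `A`, a plane which differs from the tangent plane when `D ≠ 0` and `X ≠ 0`, so they
are parallel. The kernel of `A` being the direction of the axis, `N` is parallel to a plane containing
the axis and the point (`axis_coplanar_normalPoly`), which is the equation on the Plücker
coordinates. It holds generically, hence identically.
-/

noncomputable section

namespace AffineRotation

open MvPolynomial

/-! ### Linear algebra in dimension three -/

section LinearAlgebra

variable {R : Type*} [CommRing R]

/-- The quadratic form of the adjugate of `H`, evaluated at `g`. When `g` and `H` are the gradient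
and the Hessian of a function, it is the Gaussian curvature of the level surface, multiplied by
`(g ⬝ᵥ g) ^ 2`. -/
def curv (g : Fin 3 → R) (H : Matrix (Fin 3) (Fin 3) R) : R :=
  g ⬝ᵥ (H.adjugate *ᵥ g)

/-- The cofactor matrix of `4 D H - g dᵀ`, applied to `g`. When `g`, `H` are the gradient and the
Hessian of a function, `D = curv g H`, and `d` is the gradient of `D`, it is a direction of the
affine normal of the level surface. -/
def normalDir (g d : Fin 3 → R) (D : R) (H : Matrix (Fin 3) (Fin 3) R) : Fin 3 → R :=
  ((4 * D) • H - Matrix.vecMulVec g d).adjugateᵀ *ᵥ g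

/-- The cofactor matrix of `M` describes the action of `M` on cross products. -/
theorem cross_mulVec (M : Matrix (Fin 3) (Fin 3) R) (a b : Fin 3 → R) :
    (M *ᵥ a) ⨯₃ (M *ᵥ b) = M.adjugateᵀ *ᵥ (a ⨯₃ b) := by
  rw [Matrix.adjugate_fin_three]
  ext i
  fin_cases i <;>
    simp [Matrix.mulVec, dotProduct, Fin.sum_univ_three, cross_apply] <;> ring

theorem dotProduct_normalDir (g d : Fin 3 → R) (D : R) (H : Matrix (Fin 3) (Fin 3) R) :
    g ⬝ᵥ normalDir g d D H = 16 * D ^ 2 * curv g H := by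
  rw [normalDir, curv, Matrix.adjugate_fin_three, Matrix.adjugate_fin_three]
  simp [Matrix.mulVec, dotProduct, Fin.sum_univ_three, Matrix.vecMulVec_apply]
  ring

theorem normalDir_dotProduct_mulVec (g d X : Fin 3 → R) (D : R) (H : Matrix (Fin 3) (Fin 3) R) :
    normalDir g d D H ⬝ᵥ (((4 * D) • H - Matrix.vecMulVec g d) *ᵥ X) =
      ((4 * D) • H - Matrix.vecMulVec g d).det * (g ⬝ᵥ X) := by
  rw [normalDir, Matrix.mulVec_transpose, Matrix.dotProduct_mulVec, Matrix.vecMul_vecMul,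
    Matrix.adjugate_mul, Matrix.vecMul_smul, Matrix.vecMul_one, smul_dotProduct, smul_eq_mul]

/-- On a cross product of two vectors, `curv` is the Gram determinant of the quadratic form `H` on
these vectors: the numerator of the Gaussian curvature. -/
theorem curv_eq_quadratic {H : Matrix (Fin 3) (Fin 3) R} (hH : Hᵀ = H) (a b : Fin 3 → R) :
    curv (a ⨯₃ b) H = (a ⬝ᵥ (H *ᵥ a)) * (b ⬝ᵥ (H *ᵥ b)) - (a ⬝ᵥ (H *ᵥ b)) ^ 2 := by
  have h (i j) : H i j = H j i := congrFun (congrFun hH j) i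
  rw [curv, Matrix.adjugate_fin_three]
  simp [Matrix.mulVec, dotProduct, Fin.sum_univ_three, cross_apply, h 1 0, h 2 0, h 2 1]
  ring

/-- The columns of the adjugate of `H` are parallel to every vector of the kernel of `H`. -/
theorem mul_adjugate_of_mulVec_eq_zero {H : Matrix (Fin 3) (Fin 3) R} {X : Fin 3 → R}
    (hX : H *ᵥ X = 0) (i j k : Fin 3) : X j * H.adjugate i k = X i * H.adjugate j k := by
  have h0 := congrFun hX 0
  have h1 := congrFun hX 1
  have h2 := congrFun hX 2
  rw [Matrix.adjugate_fin_three]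
  simp only [Matrix.mulVec, dotProduct, Fin.sum_univ_three, Pi.zero_apply] at h0 h1 h2
  fin_cases i <;> fin_cases j <;> fin_cases k <;> simp <;> grind

/-- If `X` is in the kernel of `H` and orthogonal to `g`, the left-hand side vanishes: the form `H`
degenerates on the plane orthogonal to `g`. -/
theorem curv_mul_sq {H : Matrix (Fin 3) (Fin 3) R} (hH : Hᵀ = H) {X : Fin 3 → R}
    (hX : H *ᵥ X = 0) (g : Fin 3 → R) (i : Fin 3) :
    curv g H * X i ^ 2 = H.adjugate i i * (g ⬝ᵥ X) ^ 2 := by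
  have hsymm (j k) : H.adjugate j k = H.adjugate k j := by
    have := congrFun (congrFun (Matrix.adjugate_transpose H) k) j
    rwa [hH] at this
  have key (j k) : X i ^ 2 * H.adjugate j k = H.adjugate i i * (X j * X k) := by
    linear_combination X i * mul_adjugate_of_mulVec_eq_zero hX j i k +
      X j * X i * hsymm i k + X j * mul_adjugate_of_mulVec_eq_zero hX k i i
  simp only [curv, Matrix.mulVec, dotProduct, sq, Finset.mul_sum, Finset.sum_mul]
  refine Finset.sum_congr rfl fun j _ => Finset.sum_congr rfl fun k _ => ?_
  linear_combination g j * g k * key j k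

/-- If the gradient and the Hessian vary as those of a function that is invariant under a flow with
linearization `C`, then `curv` varies with the factor `-2 tr C`. It is invariant when the flow
preserves volumes. -/
theorem derivation_curv {k : Type*} [CommRing k] [Algebra k R] (𝒟 : Derivation k R R)
    (g : Fin 3 → R) (H C : Matrix (Fin 3) (Fin 3) R) (hg : ∀ i, 𝒟 (g i) = -(Cᵀ *ᵥ g) i)
    (hH : ∀ i j, 𝒟 (H i j) = -(H * C + Cᵀ * H) i j) :
    𝒟 (curv g H) = -(2 * C.trace) * curv g H := by
  rw [curv, Matrix.adjugate_fin_three]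
  simp [Matrix.mulVec, dotProduct, Fin.sum_univ_three, Derivation.leibniz, hg, hH, Matrix.trace,
    Matrix.mul_apply]
  ring

theorem map_curv {S : Type*} [CommRing S] (f : R →+* S) (g : Fin 3 → R)
    (H : Matrix (Fin 3) (Fin 3) R) : f (curv g H) = curv (f ∘ g) (H.map f) := by
  rw [curv, curv, RingHom.map_dotProduct, ← RingHom.mapMatrix_apply, ← RingHom.map_adjugate]
  congr 1
  ext i
  exact RingHom.map_mulVec f _ _ i

theorem map_normalDir {S : Type*} [CommRing S] (f : R →+* S) (g d : Fin 3 → R) (D : R)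
    (H : Matrix (Fin 3) (Fin 3) R) (i : Fin 3) :
    f (normalDir g d D H i) = normalDir (f ∘ g) (f ∘ d) (f D) (H.map f) i := by
  have : ((4 * D) • H - Matrix.vecMulVec g d).map f =
      (4 * f D) • H.map f - Matrix.vecMulVec (f ∘ g) (f ∘ d) := by
    ext i j; simp [Matrix.vecMulVec_apply, map_ofNat]
  rw [normalDir, normalDir, RingHom.map_mulVec, ← this, ← RingHom.mapMatrix_apply f (_ - _),
    ← RingHom.map_adjugate, RingHom.mapMatrix_apply, Matrix.transpose_map]

end LinearAlgebra

/-- The infinitesimal generator of the group `rotationMatrix τ`: its derivative at `t = 0`. -/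
def generator : RotationType → Matrix (Fin 3) (Fin 3) ℝ
  | .elliptic => !![0, -1, 0; 1, 0, 0; 0, 0, 0]
  | .hyperbolic => !![0, 1, 0; 1, 0, 0; 0, 0, 0]
  | .parabolic => !![0, 0, 0; 1, 0, 0; 0, 1, 0]

theorem trace_generator (τ : RotationType) : (generator τ).trace = 0 := by
  cases τ <;> simp [generator, Matrix.trace, Fin.sum_univ_three]

theorem hasDerivAt_rotationMatrix_mulVec (τ : RotationType) (p : R3) (t : ℝ) :
    HasDerivAt (fun s => rotationMatrix τ s *ᵥ p)
      (generator τ *ᵥ (rotationMatrix τ t *ᵥ p)) t := by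
  rw [hasDerivAt_pi]
  have hs := Real.hasDerivAt_sin t
  have hc := Real.hasDerivAt_cos t
  have hsh := Real.hasDerivAt_sinh t
  have hch := Real.hasDerivAt_cosh t
  have hi := hasDerivAt_id t
  intro i
  cases τ <;> fin_cases i <;>
    simp [generator, rotationMatrix, Matrix.mulVec, dotProduct, Fin.sum_univ_three]
  · exact ((hc.mul_const (p 0)).fun_add (hs.mul_const (p 1)).fun_neg).congr_deriv (by ring)
  · exact (hs.mul_const (p 0)).fun_add (hc.mul_const (p 1)) |>.congr_deriv (by ring)
  · exact hasDerivAt_const ..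
  · exact (hch.mul_const (p 0)).fun_add (hsh.mul_const (p 1))
  · exact (hsh.mul_const (p 0)).fun_add (hch.mul_const (p 1))
  · exact hasDerivAt_const ..
  · exact hasDerivAt_const ..
  · exact (hi.mul_const (p 0)).congr_deriv (by simp)
  · exact ((((hi.fun_pow 2).div_const 2).mul_const (p 0)).fun_add (hi.mul_const (p 1))).congr_deriv
      (by simp)

/-- Two vectors whose images under the generator are orthogonal to `g` span, together with the
direction of the axis, at most a plane: the image of the generator meets the orthogonal complement
of `g` in a line, and its kernel is the axis. -/
theorem generator_coplanar (τ : RotationType) {g p ξ : R3} (hξ : g ⬝ᵥ (generator τ *ᵥ ξ) = 0)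
    (hp : g ⬝ᵥ (generator τ *ᵥ p) = 0) (hg : (generator τ)ᵀ *ᵥ g ≠ 0) :
    ![0, 0, 1] ⬝ᵥ (p ⨯₃ ξ) = 0 := by
  rw [Matrix.dotProduct_mulVec, ← Matrix.mulVec_transpose] at hξ hp
  have h2 : ((generator τ)ᵀ *ᵥ g) 2 = 0 := by
    cases τ <;> simp [generator, Matrix.mulVec, dotProduct, Fin.sum_univ_three]
  generalize (generator τ)ᵀ *ᵥ g = h at *
  simp only [dotProduct, Fin.sum_univ_three, h2, zero_mul, add_zero] at hξ hp
  have : h 0 ≠ 0 ∨ h 1 ≠ 0 := by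
    by_contra! hc
    exact hg (by ext i; fin_cases i <;> simp [hc, h2])
  simp [cross_apply]
  rcases this with h0 | h0
  · apply mul_left_cancel₀ h0
    linear_combination ξ 1 * hp - p 1 * hξ
  · apply mul_left_cancel₀ h0
    linear_combination p 0 * hξ - ξ 0 * hp

theorem dotProduct_cross_mulVec (L : Matrix (Fin 3) (Fin 3) ℝ) (a b c : R3) :
    (L *ᵥ a) ⬝ᵥ ((L *ᵥ b) ⨯₃ (L *ᵥ c)) = L.det * (a ⬝ᵥ (b ⨯₃ c)) := by
  rw [cross_mulVec, Matrix.dotProduct_mulVec, Matrix.vecMul_transpose, Matrix.mulVec_mulVec,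
    Matrix.adjugate_mul, Matrix.smul_mulVec, Matrix.one_mulVec, smul_dotProduct, smul_eq_mul]

theorem conj_generator_coplanar (τ : RotationType) {L L' : Matrix (Fin 3) (Fin 3) ℝ}
    (hL : L * L' = 1) {g p ξ : R3}
    (hξ : g ⬝ᵥ ((L * generator τ * L') *ᵥ ξ) = 0)
    (hp : g ⬝ᵥ ((L * generator τ * L') *ᵥ p) = 0) (hg : (L * generator τ * L')ᵀ *ᵥ g ≠ 0) :
    (L *ᵥ ![0, 0, 1]) ⬝ᵥ (p ⨯₃ ξ) = 0 := by
  have hv (v : R3) : v = L *ᵥ (L' *ᵥ v) := by rw [Matrix.mulVec_mulVec, hL, Matrix.one_mulVec]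
  have e (v : R3) : g ⬝ᵥ ((L * generator τ * L') *ᵥ v) =
      (Lᵀ *ᵥ g) ⬝ᵥ (generator τ *ᵥ (L' *ᵥ v)) := by
    rw [Matrix.mulVec_transpose, ← Matrix.dotProduct_mulVec]
    simp only [Matrix.mulVec_mulVec, Matrix.mul_assoc]
  rw [e] at hξ hp
  have hg' : (generator τ)ᵀ *ᵥ (Lᵀ *ᵥ g) ≠ 0 := by
    rintro h0
    apply hg
    rw [Matrix.transpose_mul, Matrix.transpose_mul, ← Matrix.mulVec_mulVec, ← Matrix.mulVec_mulVec,
      h0, Matrix.mulVec_zero]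
  rw [hv p, hv ξ, dotProduct_cross_mulVec, generator_coplanar τ hξ hp hg', mul_zero]

/-! ### Gradient, Hessian and curvature form of a polynomial -/

theorem pderiv_comm (i j : Fin 3) (F : Poly) : pderiv i (pderiv j F) = pderiv j (pderiv i F) := by
  have h : ⁅(pderiv i : Derivation ℝ Poly Poly), (pderiv j : Derivation ℝ Poly Poly)⁆ = 0 := by
    refine MvPolynomial.derivation_ext fun k => ?_
    simp only [Derivation.commutator_apply, pderiv_X, Derivation.zero_apply]
    by_cases h1 : i = k <;> by_cases h2 : j = k <;> simp [h1, h2, Ne.symm]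
  have := DFunLike.congr_fun h F
  rwa [Derivation.commutator_apply, Derivation.zero_apply, sub_eq_zero] at this

/-- The gradient of a polynomial. -/
def grad (F : Poly) : Fin 3 → Poly := fun i => pderiv i F

/-- The Hessian matrix of a polynomial. -/
def hess (F : Poly) : Matrix (Fin 3) (Fin 3) Poly := Matrix.of fun i j => pderiv i (pderiv j F)

theorem transpose_hess (F : Poly) : (hess F)ᵀ = hess F := by
  ext1 i j
  exact pderiv_comm j i F

/-- The Gaussian curvature of the level surfaces of `F`, multiplied by the fourth power of the
length of the gradient; it is a polynomial. -/
def curvPoly (F : Poly) : Poly := curv (grad F) (hess F)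

/-- A polynomial vector field along the affine normals of the level surfaces of `F`. -/
def normalPoly (F : Poly) : Fin 3 → Poly :=
  normalDir (grad F) (grad (curvPoly F)) (curvPoly F) (hess F)

/-- The gradient of `F` at the point `P`. -/
def gradAt (F : Poly) (P : R3) : R3 := fun i => eval P (grad F i)

/-- The Hessian matrix of `F` at the point `P`. -/
def hessAt (F : Poly) (P : R3) : Matrix (Fin 3) (Fin 3) ℝ := (hess F).map (eval P)

theorem transpose_hessAt (F : Poly) (P : R3) : (hessAt F P)ᵀ = hessAt F P := by
  rw [hessAt, ← Matrix.transpose_map, transpose_hess]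

theorem eval_curvPoly (F : Poly) (P : R3) :
    eval P (curvPoly F) = curv (gradAt F P) (hessAt F P) :=
  map_curv _ _ _

theorem eval_normalPoly (F : Poly) (P : R3) (i : Fin 3) :
    eval P (normalPoly F i) = normalDir (gradAt F P) (gradAt (curvPoly F) P)
      (eval P (curvPoly F)) (hessAt F P) i :=
  map_normalDir _ _ _ _ _ _

theorem hasFDerivAt_eval (F : Poly) (P : R3) :
    HasFDerivAt (fun p : R3 => eval p F)
      (∑ i, gradAt F P i • (ContinuousLinearMap.proj i : R3 →L[ℝ] ℝ)) P := by
  induction F using MvPolynomial.induction_on with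
  | C a => simpa [gradAt, grad] using hasFDerivAt_const a P
  | add p q hp hq =>
    simp only [map_add]
    refine (hp.fun_add hq).congr_fderiv ?_
    ext v
    simp [gradAt, grad, Fin.sum_univ_three]
    ring
  | mul_X p j hp =>
    simp only [map_mul, eval_X]
    refine (hp.fun_mul (hasFDerivAt_apply j P)).congr_fderiv ?_
    ext v
    fin_cases j <;>
    simp [gradAt, grad, Fin.sum_univ_three, Derivation.leibniz, pderiv_X, Pi.single_apply] <;> ring

theorem contDiff_eval (F : Poly) : ContDiff ℝ ω (fun p : R3 => eval p F) :=
  (AnalyticOnNhd.eval_mvPolynomial F).contDiff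

theorem hasFDerivAt_eval_comp (F : Poly) {E : Type*} [NormedAddCommGroup E] [NormedSpace ℝ E]
    {x : E → R3} {x' : E →L[ℝ] R3} {q : E} (hx : HasFDerivAt x x' q) (w : E) :
    fderiv ℝ (fun q => eval (x q) F) q w = gradAt F (x q) ⬝ᵥ x' w := by
  have h : HasFDerivAt (fun q => eval (x q) F) _ q := (hasFDerivAt_eval F (x q)).comp q hx
  rw [h.fderiv]
  simp [dotProduct]

theorem hasDerivAt_eval_comp (F : Poly) {c : ℝ → R3} {c' : R3} {t : ℝ} (hc : HasDerivAt c c' t) :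
    HasDerivAt (fun s => eval (c s) F) (gradAt F (c t) ⬝ᵥ c') t := by
  refine ((hasFDerivAt_eval F (c t)).comp_hasDerivAt t hc).congr_deriv ?_
  simp [dotProduct]

theorem hasFDerivAt_gradAt_comp (F : Poly) {E : Type*} [NormedAddCommGroup E] [NormedSpace ℝ E]
    {x : E → R3} {x' : E →L[ℝ] R3} {q : E} (hx : HasFDerivAt x x' q) :
    HasFDerivAt (fun q => gradAt F (x q)) (((hessAt F (x q)).mulVecLin.toContinuousLinearMap).comp x')
      q := by
  rw [hasFDerivAt_pi']
  intro i
  refine ((hasFDerivAt_eval (grad F i) (x q)).comp q hx).congr_fderiv ?_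
  ext w
  simp only [gradAt, ContinuousLinearMap.comp_apply, sum_apply,
    smul_apply, ContinuousLinearMap.proj_apply, smul_eq_mul,
    LinearMap.coe_toContinuousLinearMap', Matrix.mulVecLin_apply, Matrix.mulVec, dotProduct, hessAt,
    Matrix.map_apply, hess, Matrix.of_apply, grad, pderiv_comm i]

theorem totalDegree_pderiv_le (i : Fin 3) (F : Poly) :
    (pderiv i F).totalDegree ≤ F.totalDegree - 1 := by
  refine Finset.sup_le fun m hm => ?_
  have hm' : m + Finsupp.single i 1 ∈ F.support := by
    rw [mem_support_iff, coeff_pderiv] at hm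
    exact mem_support_iff.2 (left_ne_zero_of_mul hm)
  have := le_totalDegree hm'
  rw [Finsupp.sum_add_index' (by simp) (by simp)] at this
  simp at this
  omega

theorem grad_ne_zero {F : Poly} (hF : ¬ ∃ a, F = C a) : grad F ≠ 0 := by
  refine fun h => hF ⟨coeff 0 F, ?_⟩
  ext m
  rw [coeff_C]
  split_ifs with hm
  · rw [← hm]
  · obtain ⟨i, hi⟩ : ∃ i, m i ≠ 0 := by
      by_contra! hc
      exact hm (Finsupp.ext fun i => (hc i).symm)
    have h1 := congrArg (coeff (m - Finsupp.single i 1)) (congrFun h i)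
    rw [grad, coeff_pderiv, Pi.zero_apply, coeff_zero,
      tsub_add_cancel_of_le (Finsupp.single_le_iff.2 (Nat.one_le_iff_ne_zero.2 hi))] at h1
    exact (mul_eq_zero.1 h1).resolve_right (by positivity)

theorem not_exists_eq_C {F : Poly} (hF : Irreducible F) : ¬ ∃ a, F = C a := by
  rintro ⟨a, rfl⟩
  by_cases ha : a = 0
  · exact hF.ne_zero (by rw [ha, map_zero])
  · exact hF.not_isUnit ((IsUnit.mk0 a ha).map C)

/-- The affine vector field `P ↦ A P + v`, with polynomial components. -/
def affineField (A : Matrix (Fin 3) (Fin 3) ℝ) (v : R3) : Fin 3 → Poly :=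
  fun i => ∑ j, C (A i j) * X j + C (v i)

theorem eval_affineField (A : Matrix (Fin 3) (Fin 3) ℝ) (v P : R3) (i : Fin 3) :
    eval P (affineField A v i) = (A *ᵥ P + v) i := by
  simp [affineField, Matrix.mulVec, dotProduct]

theorem totalDegree_affineField_le (A : Matrix (Fin 3) (Fin 3) ℝ) (v : R3) (i : Fin 3) :
    (affineField A v i).totalDegree ≤ 1 := by
  refine (totalDegree_add _ _).trans (max_le (totalDegree_finsetSum_le fun j _ => ?_) (by simp))
  refine (totalDegree_mul _ _).trans ?_
  simp

/-- The derivative of polynomials along the affine vector field `P ↦ A P + v`. -/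
def lieDeriv (A : Matrix (Fin 3) (Fin 3) ℝ) (v : R3) : Derivation ℝ Poly Poly :=
  ∑ i, affineField A v i • pderiv i

theorem lieDeriv_apply (A : Matrix (Fin 3) (Fin 3) ℝ) (v : R3) (F : Poly) :
    lieDeriv A v F = grad F ⬝ᵥ affineField A v := by
  simp [lieDeriv, dotProduct, grad, Fin.sum_univ_three, mul_comm]

theorem eval_lieDeriv (A : Matrix (Fin 3) (Fin 3) ℝ) (v : R3) (F : Poly) (P : R3) :
    eval P (lieDeriv A v F) = gradAt F P ⬝ᵥ (A *ᵥ P + v) := by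
  simp [lieDeriv_apply, dotProduct, eval_affineField, gradAt]

theorem totalDegree_lieDeriv_le (A : Matrix (Fin 3) (Fin 3) ℝ) (v : R3) (F : Poly) :
    (lieDeriv A v F).totalDegree ≤ F.totalDegree := by
  rcases Nat.eq_zero_or_pos F.totalDegree with h | h
  · rw [totalDegree_eq_zero_iff_eq_C.1 h, ← algebraMap_eq, Derivation.map_algebraMap]
    simp
  · rw [lieDeriv_apply]
    refine totalDegree_finsetSum_le fun i _ => (totalDegree_mul _ _).trans ?_
    have h1 := totalDegree_pderiv_le i F
    have h2 := totalDegree_affineField_le A v i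
    simp only [grad]
    omega

theorem pderiv_lieDeriv (A : Matrix (Fin 3) (Fin 3) ℝ) (v : R3) (F : Poly) (j : Fin 3) :
    pderiv j (lieDeriv A v F) =
      lieDeriv A v (pderiv j F) + ((A.map C)ᵀ *ᵥ grad F) j := by
  have h (i) : pderiv j (affineField A v i) = C (A i j) := by
    fin_cases j <;>
    simp [affineField, Fin.sum_univ_three, pderiv_X]
  simp only [lieDeriv_apply, dotProduct, map_sum, pderiv_mul, h, Finset.sum_add_distrib, grad,
    Matrix.mulVec, pderiv_comm j, Matrix.transpose_apply, Matrix.map_apply]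
  congr 1
  exact Finset.sum_congr rfl fun i _ => mul_comm _ _

section Invariant

variable {A : Matrix (Fin 3) (Fin 3) ℝ} {v : R3} {F : Poly}

theorem lieDeriv_grad (h : lieDeriv A v F = 0) (j : Fin 3) :
    lieDeriv A v (grad F j) = -((A.map C)ᵀ *ᵥ grad F) j := by
  have := pderiv_lieDeriv A v F j
  rw [h, map_zero] at this
  exact eq_neg_of_add_eq_zero_left this.symm

theorem lieDeriv_hess (h : lieDeriv A v F = 0) (i j : Fin 3) :
    lieDeriv A v (hess F i j) = 
      -(hess F * A.map C + (A.map C)ᵀ * hess F : Matrix (Fin 3) (Fin 3) Poly) i j := by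
  have h1 := pderiv_lieDeriv A v (grad F j) i
  rw [lieDeriv_grad h] at h1
  have h2 : lieDeriv A v (hess F i j) =
      -pderiv i (((A.map C)ᵀ *ᵥ grad F) j) - ((A.map C)ᵀ *ᵥ grad (grad F j)) i := by
    rw [← map_neg, h1, add_sub_cancel_right]; rfl
  have h3 : pderiv i (((A.map C)ᵀ *ᵥ grad F) j) =
      (hess F * A.map C : Matrix (Fin 3) (Fin 3) Poly) i j := by
    simp only [Matrix.mulVec, dotProduct, Matrix.mul_apply, map_sum]
    refine Finset.sum_congr rfl fun k _ => ?_
    rw [Matrix.transpose_apply, Matrix.map_apply, pderiv_C_mul, mul_comm]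
    rfl
  rw [h2, h3, Matrix.add_apply, neg_add, sub_eq_add_neg]
  rfl

theorem lieDeriv_curvPoly (hA : A.trace = 0) (h : lieDeriv A v F = 0) :
    lieDeriv A v (curvPoly F) = 0 := by
  have ht : (A.map (C : ℝ → Poly)).trace = 0 := by
    have := congrArg (C : ℝ → Poly) hA
    simpa [Matrix.trace] using this
  rw [curvPoly, derivation_curv (lieDeriv A v) _ _ _ (lieDeriv_grad h) (lieDeriv_hess h), ht]
  simp

theorem gradAt_dotProduct_field (h : lieDeriv A v F = 0) (P : R3) :
    gradAt F P ⬝ᵥ (A *ᵥ P + v) = 0 := by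
  rw [← eval_lieDeriv, h, map_zero]

/-- The gradient of the identity `∇F · (A P + v) = 0`. -/
theorem hessAt_mulVec_field (h : lieDeriv A v F = 0) (P : R3) :
    hessAt F P *ᵥ (A *ᵥ P + v) = -(Aᵀ *ᵥ gradAt F P) := by
  ext j
  have := congrArg (eval P) (lieDeriv_grad h j)
  rw [eval_lieDeriv] at this
  simpa [Matrix.mulVec, dotProduct, gradAt, grad, hessAt, hess, pderiv_comm j] using this

/-- The matrix `M` of `normalDir` sends `A P + v` to `-4 D Aᵀ g`, and its image under `M` is
orthogonal to the affine normal because `A P + v` is tangent to the level surface. -/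
theorem gradAt_dotProduct_mulVec_normalPoly (hA : A.trace = 0) (h : lieDeriv A v F = 0) {P : R3}
    (hD : eval P (curvPoly F) ≠ 0) :
    gradAt F P ⬝ᵥ (A *ᵥ fun i => eval P (normalPoly F i)) = 0 := by
  have h1 := normalDir_dotProduct_mulVec (gradAt F P) (gradAt (curvPoly F) P) (A *ᵥ P + v)
    (eval P (curvPoly F)) (hessAt F P)
  rw [gradAt_dotProduct_field h, mul_zero, Matrix.sub_mulVec, Matrix.smul_mulVec,
    hessAt_mulVec_field h, Matrix.vecMulVec_mulVec, gradAt_dotProduct_field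
      (lieDeriv_curvPoly hA h)] at h1
  simp only [eval_normalPoly]
  rw [Matrix.dotProduct_mulVec, ← Matrix.mulVec_transpose, dotProduct_comm]
  simpa [hD] using h1

/-- Otherwise the tangent vector `A P + v` would be in the kernel of the Hessian, and the curvature
would vanish. -/
theorem transpose_mulVec_gradAt_ne_zero (h : lieDeriv A v F = 0) {P : R3}
    (hD : eval P (curvPoly F) ≠ 0) (hP : A *ᵥ P + v ≠ 0) : Aᵀ *ᵥ gradAt F P ≠ 0 := by
  intro h0
  obtain ⟨i, hi⟩ := Function.ne_iff.1 hP
  have h1 := curv_mul_sq (transpose_hessAt F P) (X := A *ᵥ P + v)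
    (by rw [hessAt_mulVec_field h, h0, neg_zero]) (gradAt F P) i
  rw [gradAt_dotProduct_field h, ← eval_curvPoly] at h1
  simp [hD] at h1
  exact hi h1

end Invariant

/-! ### Polynomials vanishing on a regular patch -/

/-- By Gauss's lemma `f` and `g` are coprime over the fraction field, so that their resultant does
not vanish. -/
theorem _root_.Irreducible.exists_mul_add_mul_eq_C {R : Type*} [CommRing R] [IsDomain R]
    [IsGCDMonoid R] {f g : Polynomial R} (hf : Irreducible f) (hfg : ¬ f ∣ g) :
    ∃ r : R, r ≠ 0 ∧ ∃ a b, f * a + g * b = Polynomial.C r := by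
  by_cases h0 : f.natDegree = 0
  · obtain ⟨r, rfl⟩ := Polynomial.natDegree_eq_zero.1 h0
    exact ⟨r, fun h => hf.ne_zero (by rw [h, map_zero]), 1, 0, by simp⟩
  · have hinj := IsFractionRing.injective R (FractionRing R)
    have hp := hf.isPrimitive h0
    have hirr := (hp.irreducible_iff_irreducible_map_fraction_map (K := FractionRing R)).1 hf
    have hcop := hirr.coprime_iff_not_dvd.2
      fun h => hfg (hp.dvd_of_fraction_map_dvd_fraction_map (K := FractionRing R) h)
    have hne := Polynomial.resultant_ne_zero _ _ hcop
    rw [Polynomial.natDegree_map_eq_of_injective hinj, Polynomial.natDegree_map_eq_of_injective hinj,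
      Polynomial.resultant_map_map] at hne
    obtain ⟨a, b, -, -, hab⟩ := Polynomial.exists_mul_add_mul_eq_C_resultant f g le_rfl le_rfl
      (Or.inl h0)
    exact ⟨_, fun h => hne (by rw [h, map_zero]), a, b, hab⟩

/-- Elimination of the coordinate `e 0` from `F = G = 0`: the remaining coordinates of the common
zeros satisfy a nontrivial equation. The permutation `e` serves to choose the coordinate. -/
theorem exists_elimination {F G : Poly} (hF : Irreducible F) (hFG : ¬ F ∣ G)
    (e : Equiv.Perm (Fin 3)) :
    ∃ r : MvPolynomial (Fin 2) ℝ, r ≠ 0 ∧ ∀ P : R3, eval P F = 0 → eval P G = 0 →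
      eval (fun k => P (e k.succ)) r = 0 := by
  let Φ := (renameEquiv ℝ e.symm).trans (finSuccEquiv ℝ 2)
  have hΦ (P : R3) (H : Poly) : Polynomial.eval (P (e 0))
      (Polynomial.map (eval fun k : Fin 2 => P (e k.succ)) (Φ H)) = eval P H := by
    have := eval_eq_eval_mv_eval' (fun k : Fin 2 => P (e k.succ)) (P (e 0)) (rename e.symm H)
    rw [eval_rename] at this
    refine this.symm.trans ?_
    congr 2
    ext i
    have : ∀ j : Fin 3, (Fin.cons (P (e 0)) fun k : Fin 2 => P (e k.succ) : Fin 3 → ℝ) j = P (e j) :=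
      fun j => by refine Fin.cases ?_ (fun k => ?_) j <;> simp
    simp [this]
  have h1 : Irreducible (Φ F) := (MulEquiv.irreducible_iff Φ).2 hF
  have h2 : ¬ Φ F ∣ Φ G := fun h => hFG ((map_dvd_iff Φ).1 h)
  obtain ⟨r, hr, a, b, hab⟩ := h1.exists_mul_add_mul_eq_C h2
  refine ⟨r, hr, fun P hPF hPG => ?_⟩
  have := congrArg (fun p => Polynomial.eval (P (e 0))
      (Polynomial.map (eval fun k : Fin 2 => P (e k.succ)) p)) hab
  simpa [hΦ, hPF, hPG] using this.symm

theorem eq_zero_of_eventually_eval_eq_zero {n : ℕ} {r : MvPolynomial (Fin n) ℝ} {P : Fin n → ℝ}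
    (h : ∀ᶠ p in nhds P, eval p r = 0) : r = 0 := by
  obtain ⟨ε, hε, hb⟩ := Metric.eventually_nhds_iff_ball.1 h
  refine funext_set (fun i => Metric.ball (P i) ε) (fun i => ?_) fun p hp => ?_
  · rw [Real.ball_eq_Ioo]
    exact Set.Ioo_infinite (by linarith)
  · rw [map_zero]
    apply hb
    rw [ball_pi _ hε]
    exact hp

theorem exists_perm_minor_ne_zero {a b : R3} (h : a ⨯₃ b ≠ 0) :
    ∃ e : Equiv.Perm (Fin 3), a (e 1) * b (e 2) - a (e 2) * b (e 1) ≠ 0 := by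
  by_contra! hc
  refine h ?_
  have h0 := hc (Equiv.refl _)
  have h1 := hc (Equiv.swap 0 1)
  have h2 := hc (Equiv.swap 0 2)
  have e1 : (Equiv.swap 0 1 : Equiv.Perm (Fin 3)) 2 = 2 := by decide
  have e2 : (Equiv.swap 0 2 : Equiv.Perm (Fin 3)) 1 = 1 := by decide
  simp [e1, e2] at h0 h1 h2
  ext i
  fin_cases i <;> simp [cross_apply] <;> linarith

theorem IsRegularPatch.contDiffAt {x : ℝ × ℝ → R3} {U : Set (ℝ × ℝ)} (hx : IsRegularPatch x U)
    {q : ℝ × ℝ} (hq : q ∈ U) : ContDiffAt ℝ ∞ x q :=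
  hx.contDiffOn.contDiffAt (hx.isOpen.mem_nhds hq)

theorem IsRegularPatch.hasFDerivAt {x : ℝ × ℝ → R3} {U : Set (ℝ × ℝ)} (hx : IsRegularPatch x U)
    {q : ℝ × ℝ} (hq : q ∈ U) : HasFDerivAt x (fderiv ℝ x q) q :=
  ((hx.contDiffAt hq).differentiableAt (by simp)).hasFDerivAt

theorem IsRegularPatch.mono {x : ℝ × ℝ → R3} {U V : Set (ℝ × ℝ)} (hx : IsRegularPatch x U)
    (hV : IsOpen V) (hVU : V ⊆ U) : IsRegularPatch x V :=
  ⟨hV, hx.contDiffOn.mono hVU, fun q hq => hx.regular q (hVU hq)⟩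

theorem fderiv_apply_eq (x : ℝ × ℝ → R3) (q w : ℝ × ℝ) :
    fderiv ℝ x q w = w.1 • dU x q + w.2 • dV x q := by
  rw [dU, dV, ← map_smul, ← map_smul, ← map_add]
  simp

/-- A regular patch in the zero set of an irreducible polynomial `F` determines `F`. If `F` does not
divide `G`, two coordinates of the common zeros satisfy an algebraic relation; but two of the
coordinates of the patch fill an open subset of the plane. -/
theorem IsRegularPatch.dvd_of_vanish {x : ℝ × ℝ → R3} {U : Set (ℝ × ℝ)} (hx : IsRegularPatch x U)
    (hU : U.Nonempty) {F G : Poly} (hF : Irreducible F) (hxF : ∀ q ∈ U, eval (x q) F = 0)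
    (hxG : ∀ q ∈ U, eval (x q) G = 0) : F ∣ G := by
  by_contra hFG
  obtain ⟨q, hq⟩ := hU
  obtain ⟨e, he⟩ := exists_perm_minor_ne_zero (hx.regular q hq)
  obtain ⟨r, hr, hrP⟩ := exists_elimination hF hFG e
  refine hr (eq_zero_of_eventually_eval_eq_zero (P := fun k => x q (e k.succ)) ?_)
  let π : R3 →L[ℝ] (Fin 2 → ℝ) :=
    ContinuousLinearMap.pi fun k => ContinuousLinearMap.proj (e k.succ)
  have hs : HasStrictFDerivAt (fun q => π (x q)) (π.comp (fderiv ℝ x q)) q :=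
    π.hasStrictFDerivAt.comp q ((hx.contDiffAt hq).hasStrictFDerivAt (by simp))
  have hsurj : (π.comp (fderiv ℝ x q)).range = ⊤ := by
    refine LinearMap.range_eq_top.2 fun w => ?_
    set a := dU x q
    set b := dV x q
    set m := a (e 1) * b (e 2) - a (e 2) * b (e 1)
    refine ⟨((w 0 * b (e 2) - w 1 * b (e 1)) / m, (a (e 1) * w 1 - a (e 2) * w 0) / m), ?_⟩
    ext k
    fin_cases k <;> simp [π, fderiv_apply_eq] <;> field_simp <;> simp only [m, a, b] <;> ring
  have := hs.map_nhds_eq_of_surj hsurj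
  change ∀ᶠ p in nhds (π (x q)), _
  rw [← this, Filter.eventually_map]
  filter_upwards [hx.isOpen.mem_nhds hq] with q' hq'
  exact hrP _ (hxF q' hq') (hxG q' hq')

/-! ### Affine normals of level surfaces -/

theorem fderiv_dotProduct {E : Type*} [NormedAddCommGroup E] [NormedSpace ℝ E] {f g : E → R3}
    {f' g' : E →L[ℝ] R3} {q : E} (hf : HasFDerivAt f f' q) (hg : HasFDerivAt g g' q) (w : E) :
    fderiv ℝ (fun q => f q ⬝ᵥ g q) q w = f' w ⬝ᵥ g q + f q ⬝ᵥ g' w := by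
  have h : HasFDerivAt (fun q => f q ⬝ᵥ g q) _ q :=
    HasFDerivAt.fun_sum (u := Finset.univ) fun i _ =>
      ((hasFDerivAt_pi'.1 hf i).fun_mul (hasFDerivAt_pi'.1 hg i))
  rw [h.fderiv]
  simp [dotProduct, Fin.sum_univ_three]
  ring

theorem continuousAt_dotProduct {E : Type*} [TopologicalSpace E] {f g : E → R3} {q : E}
    (hf : ContinuousAt f q) (hg : ContinuousAt g q) : ContinuousAt (fun q => f q ⬝ᵥ g q) q :=
  (Continuous.dotProduct continuous_fst continuous_snd).continuousAt.comp (hf.prodMk hg)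

theorem continuousAt_cross {E : Type*} [TopologicalSpace E] {f g : E → R3} {q : E}
    (hf : ContinuousAt f q) (hg : ContinuousAt g q) : ContinuousAt (fun q => f q ⨯₃ g q) q := by
  have hf' := continuousAt_pi.1 hf
  have hg' := continuousAt_pi.1 hg
  rw [continuousAt_pi]
  intro i
  fin_cases i
  · exact ((hf' 1).mul (hg' 2)).sub ((hf' 2).mul (hg' 1))
  · exact ((hf' 2).mul (hg' 0)).sub ((hf' 0).mul (hg' 2))
  · exact ((hf' 0).mul (hg' 1)).sub ((hf' 1).mul (hg' 0))

theorem smul_eq_smul_of_cross_eq_zero {g n : R3} (h : g ⨯₃ n = 0) :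
    (g ⬝ᵥ g) • n = (n ⬝ᵥ g) • g := by
  have := cross_cross_eq_smul_sub_smul' g g n
  rw [h, map_zero] at this
  rw [dotProduct_comm n g]
  exact (sub_eq_zero.1 this.symm).symm

theorem dotProduct_self_pos {g : R3} (hg : g ≠ 0) : 0 < g ⬝ᵥ g :=
  (Finset.sum_nonneg fun i _ => mul_self_nonneg (g i)).lt_of_ne
    fun h => hg (dotProduct_self_eq_zero.1 h.symm)

theorem hasDerivAt_abs_rpow {y : ℝ} (hy : y ≠ 0) (p : ℝ) :
    HasDerivAt (fun y => |y| ^ p) (p * |y| ^ p / y) y := by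
  have h (z : ℝ) (hz : z ≠ 0) : |z| ^ p = Real.exp (Real.log z * p) := by
    rw [Real.rpow_def_of_pos (abs_pos.2 hz), Real.log_abs]
  have h1 := ((Real.hasDerivAt_log hy).mul_const p).exp
  rw [h y hy]
  refine (h1.congr_of_eventuallyEq ?_).congr_deriv (by field_simp)
  filter_upwards [isOpen_ne.mem_nhds hy] with z hz using h z hz

section LevelSurface

variable {x : ℝ × ℝ → R3} {U : Set (ℝ × ℝ)} {F : Poly} {c : ℝ} {q : ℝ × ℝ}

theorem IsRegularPatch.contDiffAt_fderiv_apply (hx : IsRegularPatch x U) (hq : q ∈ U) (w : ℝ × ℝ) :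
    ContDiffAt ℝ ∞ (fun q => fderiv ℝ x q w) q :=
  ((hx.contDiffAt hq).fderiv_right (m := ∞) (by simp)).clm_apply contDiffAt_const

theorem gradAt_dotProduct_tangent (hx : IsRegularPatch x U) (hF : ∀ q ∈ U, eval (x q) F = c)
    (hq : q ∈ U) (w : ℝ × ℝ) : gradAt F (x q) ⬝ᵥ fderiv ℝ x q w = 0 := by
  rw [← hasFDerivAt_eval_comp F (hx.hasFDerivAt hq)]
  have : (fun q => eval (x q) F) =ᶠ[nhds q] fun _ => c := by
    filter_upwards [hx.isOpen.mem_nhds hq] with q' hq' using hF q' hq'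
  rw [this.fderiv_eq]
  simp

/-- The second fundamental form of a level surface, up to scaling, is the Hessian restricted to the
tangent plane. -/
theorem gradAt_dotProduct_second_deriv (hx : IsRegularPatch x U) (hF : ∀ q ∈ U, eval (x q) F = c)
    (hq : q ∈ U) (w w' : ℝ × ℝ) :
    gradAt F (x q) ⬝ᵥ fderiv ℝ (fun q => fderiv ℝ x q w) q w' =
      -(fderiv ℝ x q w ⬝ᵥ (hessAt F (x q) *ᵥ fderiv ℝ x q w')) := by
  have h2 := ((hx.contDiffAt_fderiv_apply hq w).differentiableAt (by simp)).hasFDerivAt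
  have h := fderiv_dotProduct (hasFDerivAt_gradAt_comp F (hx.hasFDerivAt hq)) h2 w'
  have : (fun q => gradAt F (x q) ⬝ᵥ fderiv ℝ x q w) =ᶠ[nhds q] fun _ => 0 := by
    filter_upwards [hx.isOpen.mem_nhds hq] with q' hq' using gradAt_dotProduct_tangent hx hF hq' w
  rw [this.fderiv_eq] at h
  simp only [fderiv_fun_const, Pi.zero_apply, zero_apply, ContinuousLinearMap.comp_apply,
    LinearMap.coe_toContinuousLinearMap', Matrix.mulVecLin_apply] at h
  rw [dotProduct_comm (fderiv ℝ x q w)]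
  linarith

theorem smul_cross_eq (hx : IsRegularPatch x U) (hF : ∀ q ∈ U, eval (x q) F = c) (hq : q ∈ U) :
    (gradAt F (x q) ⬝ᵥ gradAt F (x q)) • (dU x q ⨯₃ dV x q) =
      ((dU x q ⨯₃ dV x q) ⬝ᵥ gradAt F (x q)) • gradAt F (x q) := by
  apply smul_eq_smul_of_cross_eq_zero
  have h1 := gradAt_dotProduct_tangent hx hF hq (1, 0)
  have h2 := gradAt_dotProduct_tangent hx hF hq (0, 1)
  rw [cross_cross_eq_smul_sub_smul', dotProduct_comm (dU x q)]
  change gradAt F (x q) ⬝ᵥ dU x q = 0 at h1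
  change gradAt F (x q) ⬝ᵥ dV x q = 0 at h2
  rw [h1, h2, zero_smul, zero_smul, sub_zero]

theorem exists_cross_eq_smul (hx : IsRegularPatch x U) (hF : ∀ q ∈ U, eval (x q) F = c)
    (hq : q ∈ U) (hg : gradAt F (x q) ≠ 0) :
    ∃ l : ℝ, l ≠ 0 ∧ dU x q ⨯₃ dV x q = l • gradAt F (x q) := by
  have hpos := dotProduct_self_pos hg
  have h : dU x q ⨯₃ dV x q = (((dU x q ⨯₃ dV x q) ⬝ᵥ gradAt F (x q)) /
      (gradAt F (x q) ⬝ᵥ gradAt F (x q))) • gradAt F (x q) := by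
    rw [div_eq_inv_mul, mul_smul, ← smul_cross_eq hx hF hq, smul_smul, inv_mul_cancel₀ hpos.ne',
      one_smul]
  exact ⟨_, fun h0 => hx.regular q hq (by rw [h, h0, zero_smul]), h⟩

theorem gaussCurvature_eq (hx : IsRegularPatch x U) (hF : ∀ q ∈ U, eval (x q) F = c) (hq : q ∈ U)
    (hg : gradAt F (x q) ≠ 0) :
    gaussCurvature x q = eval (x q) (curvPoly F) / (gradAt F (x q) ⬝ᵥ gradAt F (x q)) ^ 2 := by
  have hpos := dotProduct_self_pos hg
  obtain ⟨l, hl, hn⟩ := exists_cross_eq_smul hx hF hq hg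
  have hden := cross_dot_cross (dU x q) (dV x q) (dU x q) (dV x q)
  rw [dotProduct_comm (dV x q) (dU x q), ← sq] at hden
  have huu := gradAt_dotProduct_second_deriv hx hF hq (1, 0) (1, 0)
  have hvv := gradAt_dotProduct_second_deriv hx hF hq (0, 1) (0, 1)
  have huv := gradAt_dotProduct_second_deriv hx hF hq (1, 0) (0, 1)
  change gradAt F (x q) ⬝ᵥ dU (dU x) q = -(dU x q ⬝ᵥ (hessAt F (x q) *ᵥ dU x q)) at huu
  change gradAt F (x q) ⬝ᵥ dV (dV x) q = -(dV x q ⬝ᵥ (hessAt F (x q) *ᵥ dV x q)) at hvv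
  change gradAt F (x q) ⬝ᵥ dV (dU x) q = -(dU x q ⬝ᵥ (hessAt F (x q) *ᵥ dV x q)) at huv
  have hK := curv_eq_quadratic (transpose_hessAt F (x q)) (dU x q) (dV x q)
  have hsq : ((Real.sqrt ((dU x q ⨯₃ dV x q) ⬝ᵥ (dU x q ⨯₃ dV x q)))⁻¹) ^ 2 =
      ((dU x q ⨯₃ dV x q) ⬝ᵥ (dU x q ⨯₃ dV x q))⁻¹ := by
    rw [inv_pow, Real.sq_sqrt (dotProduct_self_pos (hx.regular q hq)).le]
  rw [gaussCurvature, ← hden, eval_curvPoly]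
  simp only [unitNormal]
  generalize (Real.sqrt ((dU x q ⨯₃ dV x q) ⬝ᵥ (dU x q ⨯₃ dV x q)))⁻¹ = s at *
  rw [hn] at hK hsq ⊢
  have hcurv : curv (l • gradAt F (x q)) (hessAt F (x q)) =
      l ^ 2 * curv (gradAt F (x q)) (hessAt F (x q)) := by
    simp only [curv, Matrix.mulVec_smul, smul_dotProduct, dotProduct_smul, smul_eq_mul]
    ring
  rw [hcurv] at hK
  simp only [smul_dotProduct, dotProduct_smul, smul_eq_mul, huu, hvv, huv] at hsq ⊢
  rw [show ∀ A B D : ℝ, s * (l * -A) * (s * (l * -B)) - (s * (l * -D)) ^ 2 =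
      s ^ 2 * l ^ 2 * (A * B - D ^ 2) from fun A B D => by ring, ← hK, hsq]
  field_simp

theorem conormal_eq (hx : IsRegularPatch x U) (hF : ∀ q ∈ U, eval (x q) F = c) (hq : q ∈ U)
    (hg : gradAt F (x q) ≠ 0) :
    conormal x q = (((dU x q ⨯₃ dV x q) ⬝ᵥ gradAt F (x q)) /
      |(dU x q ⨯₃ dV x q) ⬝ᵥ gradAt F (x q)| * |eval (x q) (curvPoly F)| ^ (-(1 / 4) : ℝ)) •
        gradAt F (x q) := by
  have hpos := dotProduct_self_pos hg
  obtain ⟨l, hl, hn⟩ := exists_cross_eq_smul hx hF hq hg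
  rw [conormal, unitNormal, gaussCurvature_eq hx hF hq hg, hn, smul_smul, smul_smul]
  congr 1
  simp only [smul_dotProduct, dotProduct_smul, smul_eq_mul]
  generalize gradAt F (x q) ⬝ᵥ gradAt F (x q) = G at hpos ⊢
  generalize eval (x q) (curvPoly F) = D
  have h1 : (G ^ 2) ^ (-(1 / 4) : ℝ) = (Real.sqrt G)⁻¹ := by
    rw [← Real.rpow_natCast, ← Real.rpow_mul hpos.le, Real.sqrt_eq_rpow, ← Real.rpow_neg hpos.le]
    norm_num
  have h2 : Real.sqrt (l * (l * G)) = |l| * Real.sqrt G := by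
    rw [← mul_assoc, ← sq, Real.sqrt_mul (sq_nonneg l), Real.sqrt_sq_eq_abs]
  have hs : Real.sqrt G ≠ 0 := (Real.sqrt_pos.2 hpos).ne'
  have hl' : |l| ≠ 0 := abs_ne_zero.2 hl
  rw [abs_div, abs_of_pos (pow_pos hpos 2), Real.div_rpow (abs_nonneg _) (by positivity), h1, h2,
    abs_mul, abs_of_pos hpos]
  field_simp

/-- The affine normal of a level surface is a nonzero multiple of the polynomial vector field
`normalPoly F`, where the curvature does not vanish. -/
theorem exists_affineNormal_eq (hx : IsRegularPatch x U) (hF : ∀ q ∈ U, eval (x q) F = c)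
    (hq : q ∈ U) (hg : gradAt F (x q) ≠ 0) (hD : eval (x q) (curvPoly F) ≠ 0) :
    ∃ a : ℝ, a ≠ 0 ∧ affineNormal x q = a • fun i => eval (x q) (normalPoly F i) := by
  have hcont : ContinuousAt (fun q => (dU x q ⨯₃ dV x q) ⬝ᵥ gradAt F (x q)) q :=
    continuousAt_dotProduct (continuousAt_cross (hx.contDiffAt_fderiv_apply hq _).continuousAt
      (hx.contDiffAt_fderiv_apply hq _).continuousAt)
      (hasFDerivAt_gradAt_comp F (hx.hasFDerivAt hq)).continuousAt
  have hcontg : ContinuousAt (fun q => gradAt F (x q)) q :=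
    (hasFDerivAt_gradAt_comp F (hx.hasFDerivAt hq)).continuousAt
  obtain ⟨l, hl, hn⟩ := exists_cross_eq_smul hx hF hq hg
  have hpos := dotProduct_self_pos hg
  -- The sign in the formula for the co-normal is locally constant.
  obtain ⟨σ, hσ, hν⟩ : ∃ σ : ℝ, σ ≠ 0 ∧ conormal x =ᶠ[nhds q] fun q =>
      (σ * |eval (x q) (curvPoly F)| ^ (-(1 / 4) : ℝ)) • gradAt F (x q) := by
    have h0 : (dU x q ⨯₃ dV x q) ⬝ᵥ gradAt F (x q) ≠ 0 := by
      rw [hn, smul_dotProduct, smul_eq_mul]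
      exact mul_ne_zero hl hpos.ne'
    rcases lt_or_gt_of_ne h0 with h0 | h0
    · refine ⟨-1, by simp, ?_⟩
      filter_upwards [hcont.eventually_lt_const h0, hcontg.eventually_ne hg,
        hx.isOpen.mem_nhds hq] with q' h1 h2 h3
      rw [conormal_eq hx hF h3 h2, abs_of_neg h1, div_neg, div_self h1.ne]
    · refine ⟨1, by simp, ?_⟩
      filter_upwards [hcont.eventually_const_lt h0, hcontg.eventually_ne hg,
        hx.isOpen.mem_nhds hq] with q' h1 h2 h3
      rw [conormal_eq hx hF h3 h2, abs_of_pos h1, div_self h1.ne']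
  set D := eval (x q) (curvPoly F) with hDdef
  set M := (4 * D) • hessAt F (x q) - Matrix.vecMulVec (gradAt F (x q)) (gradAt (curvPoly F) (x q))
    with hM
  set ρ := |D| ^ (-(1 / 4) : ℝ) with hρ
  have hρ0 : ρ ≠ 0 := (Real.rpow_pos_of_pos (abs_pos.2 hD) _).ne'
  have hder (w : ℝ × ℝ) : fderiv ℝ (conormal x) q w =
      (σ * ρ / (4 * D)) • (M *ᵥ fderiv ℝ x q w) := by
    have hDx : HasFDerivAt (fun q => eval (x q) (curvPoly F)) _ q :=
      (hasFDerivAt_eval (curvPoly F) (x q)).comp q (hx.hasFDerivAt hq)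
    have hd := HasDerivAt.comp_hasFDerivAt (f := fun q => eval (x q) (curvPoly F)) q
      (hasDerivAt_abs_rpow hD (-(1 / 4))) hDx
    have hr : HasFDerivAt (fun q => |eval (x q) (curvPoly F)| ^ (-(1 / 4) : ℝ)) _ q := hd
    have := ((hr.const_mul σ).fun_smul (hasFDerivAt_gradAt_comp F (hx.hasFDerivAt hq)))
    rw [hν.fderiv_eq, this.fderiv]
    ext i
    rw [← hDdef, ← hρ]
    simp [hM, Matrix.sub_mulVec, Matrix.smul_mulVec, Matrix.vecMulVec_mulVec, dotProduct,
      Fin.sum_univ_three]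
    field_simp
    ring
  have hcr : dU (conormal x) q ⨯₃ dV (conormal x) q =
      ((σ * ρ / (4 * D)) ^ 2 * l) • fun i => eval (x q) (normalPoly F i) := by
    simp only [dU, dV, hder]
    simp only [map_smul, LinearMap.smul_apply, cross_mulVec]
    change _ • _ • M.adjugateᵀ *ᵥ (dU x q ⨯₃ dV x q) = _
    rw [hn, Matrix.mulVec_smul, smul_smul, smul_smul]
    simp only [eval_normalPoly]
    rw [sq]
    rfl
  refine ⟨_, ?_, by rw [affineNormal, hcr, smul_smul]⟩
  rw [← triple_product_eq_det, hcr, hν.eq_of_nhds, smul_dotProduct, dotProduct_smul]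
  simp only [eval_normalPoly]
  rw [dotProduct_normalDir, ← eval_curvPoly]
  simp only [smul_eq_mul]
  positivity

end LevelSurface

theorem IsRegularPatch.continuousAt_gaussCurvature {x : ℝ × ℝ → R3} {U : Set (ℝ × ℝ)} {q : ℝ × ℝ}
    (hx : IsRegularPatch x U) (hq : q ∈ U) : ContinuousAt (gaussCurvature x) q := by
  have h1 (w) : ContinuousAt (fun q => fderiv ℝ x q w) q :=
    (hx.contDiffAt_fderiv_apply hq w).continuousAt
  have h2 (w w') : ContinuousAt (fun q => fderiv ℝ (fun q => fderiv ℝ x q w) q w') q :=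
    (((hx.contDiffAt_fderiv_apply hq w).fderiv_right (m := ∞) (by simp)).clm_apply
      contDiffAt_const).continuousAt
  have hu : ContinuousAt (dU x) q := h1 _
  have hv : ContinuousAt (dV x) q := h1 _
  have huu : ContinuousAt (dU (dU x)) q := h2 _ _
  have huv : ContinuousAt (dV (dU x)) q := h2 _ _
  have hvv : ContinuousAt (dV (dV x)) q := h2 _ _
  have hc := continuousAt_cross hu hv
  have hpos := dotProduct_self_pos (hx.regular q hq)
  have hN : ContinuousAt (unitNormal x) q :=
    ((continuousAt_dotProduct hc hc).sqrt.inv₀ (Real.sqrt_pos.2 hpos).ne').smul hc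
  have hden := cross_dot_cross (dU x q) (dV x q) (dU x q) (dV x q)
  rw [dotProduct_comm (dV x q) (dU x q), ← sq] at hden
  refine (((continuousAt_dotProduct hN huu).mul (continuousAt_dotProduct hN hvv)).sub
    ((continuousAt_dotProduct hN huv).pow 2)).div
    (((continuousAt_dotProduct hu hu).mul (continuousAt_dotProduct hv hv)).sub
    ((continuousAt_dotProduct hu hv).pow 2)) ?_
  rw [← hden]
  exact hpos.ne'

/-- The level surface `F = 0` is curved, but `gaussCurvature_eq` needs a point of nonzero gradient. If
the gradient vanished along a patch, `F` would divide its own partial derivatives. -/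
theorem curvPoly_ne_zero {F : Poly} (hF : Irreducible F) (hK : HasNonzeroCurvature (zeroSet F)) :
    curvPoly F ≠ 0 := by
  intro h0
  obtain ⟨x, U, hx, hxF, q, hq, hKq⟩ := hK
  -- `V` is a smaller patch, on which the curvature has no zero.
  obtain ⟨V, hV, hVo, hqV⟩ := eventually_nhds_iff.1
    (((hx.continuousAt_gaussCurvature hq).eventually_ne hKq).and (hx.isOpen.mem_nhds hq))
  have hxV : IsRegularPatch x V := hx.mono hVo fun p hp => (hV p hp).2
  have hg (p) (hp : p ∈ V) : gradAt F (x p) = 0 := by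
    by_contra hne
    apply (hV p hp).1
    rw [gaussCurvature_eq hxV (fun p hp => hxF p (hV p hp).2) hp hne, h0, map_zero, zero_div]
  obtain ⟨i, hi⟩ := Function.ne_iff.1 (grad_ne_zero (not_exists_eq_C hF))
  have hdvd : F ∣ grad F i := hxV.dvd_of_vanish ⟨q, hqV⟩ hF (fun p hp => hxF p (hV p hp).2)
    fun p hp => congrFun (hg p hp) i
  have h1 := totalDegree_le_of_dvd_of_isDomain hdvd hi
  have h2 : (grad F i).totalDegree ≤ _ := totalDegree_pderiv_le i F
  have h3 : F.totalDegree ≠ 0 := fun h =>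
    not_exists_eq_C hF ⟨_, totalDegree_eq_zero_iff_eq_C.1 h⟩
  omega

/-! ### Level surfaces are regular patches where the gradient does not vanish -/

theorem mul_comm_of_cross_eq_zero {a b : R3} (h : a ⨯₃ b = 0) (i j : Fin 3) :
    a i * b j = a j * b i := by
  have h0 := congrFun h 0
  have h1 := congrFun h 1
  have h2 := congrFun h 2
  simp [cross_apply] at h0 h1 h2
  fin_cases i <;> fin_cases j <;> simp <;> linarith

/-- A level surface is parametrized by two of the coordinates near a point with nonzero gradient, by
the inverse function theorem. -/
theorem exists_patch_of_gradAt_ne_zero {F : Poly} {P : R3} (hg : gradAt F P ≠ 0) :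
    ∃ (x : ℝ × ℝ → R3) (U : Set (ℝ × ℝ)), IsRegularPatch x U ∧
      (∀ q ∈ U, eval (x q) F = eval P F) ∧ ∃ q ∈ U, x q = P := by
  obtain ⟨i, hi⟩ := Function.ne_iff.1 hg
  let e : Equiv.Perm (Fin 3) := Equiv.swap 0 i
  have he : e 0 = i := Equiv.swap_apply_left 0 i
  have hsum (f : Fin 3 → ℝ) : ∑ j, f j = f (e 0) + f (e 1) + f (e 2) := by
    rw [← Equiv.sum_comp e, Fin.sum_univ_three]
  let Φ : R3 → R3 := fun p => ![eval p F, p (e 1), p (e 2)]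
  let Φ' : R3 →L[ℝ] R3 := ContinuousLinearMap.pi
    ![∑ i, gradAt F P i • (ContinuousLinearMap.proj i : R3 →L[ℝ] ℝ),
      ContinuousLinearMap.proj (e 1), ContinuousLinearMap.proj (e 2)]
  have hΦ : ContDiff ℝ ω Φ := by
    rw [contDiff_pi]
    intro j
    fin_cases j
    · exact contDiff_eval F
    · exact contDiff_apply ℝ ℝ (e 1)
    · exact contDiff_apply ℝ ℝ (e 2)
  have hΦ' : HasFDerivAt Φ Φ' P := by
    rw [hasFDerivAt_pi']
    intro j
    fin_cases j
    · exact hasFDerivAt_eval F P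
    · exact hasFDerivAt_apply (e 1) P
    · exact hasFDerivAt_apply (e 2) P
  have hinj : Function.Injective Φ'.toLinearMap := by
    rw [injective_iff_map_eq_zero]
    intro v hv
    have h0 : ∑ j, gradAt F P j * v j = 0 := by simpa [Φ'] using congrFun hv 0
    have h1 : v (e 1) = 0 := congrFun hv 1
    have h2 : v (e 2) = 0 := congrFun hv 2
    rw [hsum, h1, h2, he] at h0
    simp only [mul_zero, add_zero] at h0
    have h3 : v (e 0) = 0 := by rw [he]; exact (mul_eq_zero.1 h0).resolve_left hi
    ext j
    obtain ⟨k, rfl⟩ := e.surjective j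
    fin_cases k
    exacts [h3, h1, h2]
  let E : R3 ≃L[ℝ] R3 := (LinearEquiv.ofInjectiveEndo Φ'.toLinearMap hinj).toContinuousLinearEquiv
  have hE : HasFDerivAt Φ (E : R3 →L[ℝ] R3) P := by
    convert hΦ' using 1
    ext1 v
    rfl
  have hω : (ω : WithTop ℕ∞) ≠ 0 := by simp
  let Ψ := hΦ.contDiffAt.localInverse hE hω
  have hΨ : ContDiffAt ℝ ω Ψ (Φ P) := hΦ.contDiffAt.to_localInverse hE hω
  have hinv : ∀ᶠ y in nhds (Φ P), Φ (Ψ y) = y :=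
    (hΦ.contDiffAt.hasStrictFDerivAt' hE hω).eventually_right_inverse
  have hΨP : Ψ (Φ P) = P := hΦ.contDiffAt.localInverse_apply_image hE hω
  let y : ℝ × ℝ → R3 := fun q => ![eval P F, q.1, q.2]
  let q₀ : ℝ × ℝ := (P (e 1), P (e 2))
  have hy : ContDiff ℝ ω y := by
    rw [contDiff_pi]
    intro j
    fin_cases j
    · exact contDiff_const
    · exact contDiff_fst
    · exact contDiff_snd
  have hyq : y q₀ = Φ P := rfl
  have hx : ContDiffAt ℝ ω (fun q => Ψ (y q)) q₀ := ContDiffAt.comp q₀ hΨ hy.contDiffAt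
  -- Analyticity at a point, unlike `C^∞` smoothness at a point, extends to a neighborhood.
  obtain ⟨U, hU, hUo, hqU⟩ := eventually_nhds_iff.1
    ((hx.eventually (by simp)).and (hy.continuous.continuousAt.eventually hinv))
  have hdiff (q) (hq : q ∈ U) : HasFDerivAt (fun q => Ψ (y q)) (fderiv ℝ (fun q => Ψ (y q)) q) q :=
    ((hU q hq).1.differentiableAt hω).hasFDerivAt
  have h1 (q) (hq : q ∈ U) (w : ℝ × ℝ) : fderiv ℝ (fun q => Ψ (y q)) q w (e 1) = w.1 := by
    have : (fun q => Ψ (y q) (e 1)) =ᶠ[nhds q] Prod.fst := by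
      filter_upwards [hUo.mem_nhds hq] with q' hq' using congrFun (hU q' hq').2 1
    have h := this.fderiv_eq (𝕜 := ℝ)
    rw [(hasFDerivAt_pi'.1 (hdiff q hq) (e 1)).fderiv, fderiv_fst] at h
    exact DFunLike.congr_fun h w
  have h2 (q) (hq : q ∈ U) (w : ℝ × ℝ) : fderiv ℝ (fun q => Ψ (y q)) q w (e 2) = w.2 := by
    have : (fun q => Ψ (y q) (e 2)) =ᶠ[nhds q] Prod.snd := by
      filter_upwards [hUo.mem_nhds hq] with q' hq' using congrFun (hU q' hq').2 2
    have h := this.fderiv_eq (𝕜 := ℝ)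
    rw [(hasFDerivAt_pi'.1 (hdiff q hq) (e 2)).fderiv, fderiv_snd] at h
    exact DFunLike.congr_fun h w
  refine ⟨fun q => Ψ (y q), U, ⟨hUo, fun q hq => ?_, fun q hq h0 => ?_⟩, fun q hq => ?_, q₀, hqU, ?_⟩
  · exact ((hU q hq).1.of_le le_top).contDiffWithinAt
  · have := mul_comm_of_cross_eq_zero h0 (e 1) (e 2)
    simp [dU, dV, h1 q hq, h2 q hq] at this
  · exact congrFun (hU q hq).2 0
  · exact hΨP

/-! ### The polynomial is invariant under the rotations of its zero set -/

theorem exists_matrix_affineEquiv (T : R3 ≃ᵃ[ℝ] R3) :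
    ∃ (L L' : Matrix (Fin 3) (Fin 3) ℝ) (b : R3), L * L' = 1 ∧ ∀ p, T p = L *ᵥ p + b := by
  refine ⟨LinearMap.toMatrix' T.linear.toLinearMap, LinearMap.toMatrix' T.linear.symm.toLinearMap,
    T 0, ?_, fun p => ?_⟩
  · rw [← LinearMap.toMatrix'_comp]
    simp
  · rw [LinearMap.toMatrix'_mulVec]
    have := T.map_vadd 0 p
    simpa using this

theorem rotationMatrix_zero (τ : RotationType) : rotationMatrix τ 0 = 1 := by
  cases τ <;> ext i j <;> fin_cases i <;> fin_cases j <;> simp [rotationMatrix]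

section Flow

variable {τ : RotationType} {L L' : Matrix (Fin 3) (Fin 3) ℝ} {b : R3} {F : Poly}

/-- The derivative along the vector field of the rotations about the image of the `z`-axis under
`p ↦ L p + b`. The matrix `L'` stands for the inverse of `L`. -/
def axisField (τ : RotationType) (L L' : Matrix (Fin 3) (Fin 3) ℝ) (b : R3) :
    Derivation ℝ Poly Poly :=
  lieDeriv (L * generator τ * L') (-((L * generator τ * L') *ᵥ b))

theorem trace_conj_generator (hL : L * L' = 1) : (L * generator τ * L').trace = 0 := by
  rw [Matrix.trace_mul_comm, ← Matrix.mul_assoc, mul_eq_one_comm.1 hL, Matrix.one_mul,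
    trace_generator]

theorem hasDerivAt_eval_orbit (hL : L * L' = 1) (F : Poly) (p : R3) (t : ℝ) :
    HasDerivAt (fun s => eval (L *ᵥ (rotationMatrix τ s *ᵥ p) + b) F)
      (eval (L *ᵥ (rotationMatrix τ t *ᵥ p) + b) (axisField τ L L' b F)) t := by
  have h1 : HasDerivAt (fun s => L *ᵥ (rotationMatrix τ s *ᵥ p) + b)
      (L *ᵥ (generator τ *ᵥ (rotationMatrix τ t *ᵥ p))) t :=
    (L.mulVecLin.toContinuousLinearMap.hasFDerivAt.comp_hasDerivAt t
      (hasDerivAt_rotationMatrix_mulVec τ p t)).add_const b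
  refine (hasDerivAt_eval_comp F h1).congr_deriv ?_
  rw [axisField, eval_lieDeriv, Matrix.mulVec_add, add_neg_cancel_right]
  simp only [Matrix.mulVec_mulVec]
  rw [← Matrix.mul_assoc _ L, Matrix.mul_assoc _ L' L, mul_eq_one_comm.1 hL, Matrix.mul_one,
    Matrix.mul_assoc]

/-- The vector field of the rotations is tangent to the zero set, so that `F` divides its derivative
along this field; the quotient is constant for reasons of degree. -/
theorem axisField_eq_C_mul (hL : L * L' = 1) (hF : Irreducible F)
    (hK : HasNonzeroCurvature (zeroSet F))
    (hS : ∀ t p, eval (L *ᵥ p + b) F = 0 → eval (L *ᵥ (rotationMatrix τ t *ᵥ p) + b) F = 0) :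
    ∃ k : ℝ, axisField τ L L' b F = C k * F := by
  have hvan (P : R3) (hP : eval P F = 0) : eval P (axisField τ L L' b F) = 0 := by
    obtain ⟨p, rfl⟩ : ∃ p, L *ᵥ p + b = P :=
      ⟨L' *ᵥ (P - b), by rw [Matrix.mulVec_mulVec, hL, Matrix.one_mulVec, sub_add_cancel]⟩
    have h := hasDerivAt_eval_orbit (τ := τ) (b := b) hL F p 0
    rw [rotationMatrix_zero, Matrix.one_mulVec] at h
    have h0 : (fun s => eval (L *ᵥ (rotationMatrix τ s *ᵥ p) + b) F) = fun _ => 0 := by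
      funext s
      exact hS s p hP
    rw [h0] at h
    exact h.unique (hasDerivAt_const (0 : ℝ) (0 : ℝ))
  obtain ⟨x, U, hx, hxF, q, hq, -⟩ := hK
  obtain ⟨G, hG⟩ := hx.dvd_of_vanish ⟨q, hq⟩ hF hxF fun q hq => hvan _ (hxF q hq)
  by_cases hG0 : G = 0
  · exact ⟨0, by rw [hG, hG0, mul_zero, map_zero, zero_mul]⟩
  have hdeg : (axisField τ L L' b F).totalDegree ≤ F.totalDegree := totalDegree_lieDeriv_le _ _ F
  rw [hG, totalDegree_mul_of_isDomain hF.ne_zero hG0] at hdeg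
  have hC := totalDegree_eq_zero_iff_eq_C.1 (show G.totalDegree = 0 by omega)
  exact ⟨_, by rw [hG, mul_comm, ← hC]⟩

theorem eval_orbit {k : ℝ} (hL : L * L' = 1) (hk : axisField τ L L' b F = C k * F) (p : R3)
    (t : ℝ) : eval (L *ᵥ (rotationMatrix τ t *ᵥ p) + b) F =
      Real.exp (k * t) * eval (L *ᵥ p + b) F := by
  have h (t : ℝ) : HasDerivAt (fun s => eval (L *ᵥ (rotationMatrix τ s *ᵥ p) + b) F *
      Real.exp (-(k * s))) 0 t := by
    have h1 := hasDerivAt_eval_orbit (τ := τ) (b := b) hL F p t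
    have h2 := ((hasDerivAt_id t).const_mul k).fun_neg.exp
    refine (h1.fun_mul h2).congr_deriv ?_
    rw [hk, map_mul, eval_C]
    simp
    ring
  have := is_const_of_deriv_eq_zero (fun t => (h t).differentiableAt) (fun t => (h t).deriv) t 0
  rw [rotationMatrix_zero, Matrix.one_mulVec, mul_zero, neg_zero, Real.exp_zero, mul_one] at this
  rw [← this, mul_comm, mul_assoc, ← Real.exp_add]
  simp

theorem exists_eval_ne_zero (hL : L * L' = 1) (b : R3) (hF : F ≠ 0) :
    ∃ p, eval (L *ᵥ p + b) F ≠ 0 := by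
  by_contra! h
  refine hF (MvPolynomial.funext fun P => ?_)
  have := h (L' *ᵥ (P - b))
  rwa [Matrix.mulVec_mulVec, hL, Matrix.one_mulVec, sub_add_cancel] at this

theorem eq_zero_of_elliptic {k : ℝ} (hL : L * L' = 1) (hF : F ≠ 0)
    (hk : axisField .elliptic L L' b F = C k * F) : k = 0 := by
  obtain ⟨p, hp⟩ := exists_eval_ne_zero hL b hF
  have h := eval_orbit hL hk p (2 * Real.pi)
  have h1 : rotationMatrix .elliptic (2 * Real.pi) = 1 := by
    rw [← rotationMatrix_zero .elliptic]
    simp [rotationMatrix]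
  rw [h1, Matrix.one_mulVec] at h
  have h2 := mul_right_cancel₀ hp ((one_mul _).trans h)
  have h3 := Real.exp_eq_one_iff _ |>.1 h2.symm
  simpa [Real.pi_ne_zero] using h3

/-- Along a curve with polynomial coordinates, `F` is a polynomial in the parameter. -/
theorem eval_polynomial_curve (c : Fin 3 → Polynomial ℝ) (F : Poly) (t : ℝ) :
    (aeval c F).eval t = eval (fun i => (c i).eval t) F := by
  have := comp_aeval_apply (R := ℝ) c (Polynomial.aeval t) F
  simpa [Polynomial.coe_aeval_eq_eval, aeval_eq_eval] using this

theorem eq_zero_of_parabolic {k : ℝ} (hL : L * L' = 1) (hF : F ≠ 0)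
    (hk : axisField .parabolic L L' b F = C k * F) : k = 0 := by
  by_contra hk0
  obtain ⟨p, hp⟩ := exists_eval_ne_zero hL b hF
  let o : Fin 3 → Polynomial ℝ := ![Polynomial.C (p 0), Polynomial.C (p 0) * Polynomial.X +
    Polynomial.C (p 1), Polynomial.C (p 0 / 2) * Polynomial.X ^ 2 + Polynomial.C (p 1) *
      Polynomial.X + Polynomial.C (p 2)]
  let c : Fin 3 → Polynomial ℝ := fun i => ∑ j, Polynomial.C (L i j) * o j + Polynomial.C (b i)
  have hc (t : ℝ) : (fun i => (c i).eval t) = L *ᵥ (rotationMatrix .parabolic t *ᵥ p) + b := by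
    ext i
    simp [c, o, Matrix.mulVec, dotProduct, rotationMatrix, Fin.sum_univ_three]
    ring
  have hexp (s : ℝ) : ((aeval c F).comp (Polynomial.C k⁻¹ * Polynomial.X)).eval s / Real.exp s =
      eval (L *ᵥ p + b) F := by
    rw [Polynomial.eval_comp, eval_polynomial_curve, hc, eval_orbit hL hk]
    simp only [Polynomial.eval_mul, Polynomial.eval_C, Polynomial.eval_X]
    rw [mul_inv_cancel_left₀ hk0]
    field_simp
  have h := Polynomial.tendsto_div_exp_atTop
    ((aeval c F).comp (Polynomial.C k⁻¹ * Polynomial.X))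
  simp only [hexp] at h
  exact hp (tendsto_nhds_unique tendsto_const_nhds h)

theorem curvPoly_eq_zero_of_totalDegree_le_one (h : F.totalDegree ≤ 1) : curvPoly F = 0 := by
  have : hess F = 0 := by
    ext1 i j
    have h1 := totalDegree_pderiv_le j F
    rw [hess, Matrix.of_apply, totalDegree_eq_zero_iff_eq_C.1 (show (pderiv j F).totalDegree = 0 by
      omega), pderiv_C]
    rfl
  rw [curvPoly, curv, this, Matrix.adjugate_zero, Matrix.zero_mulVec, dotProduct_zero]

/-- If `k ≠ 0`, then `F` vanishes on one of the two planes of points whose orbits converge to the axis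
in the direction where the factor `exp (k t)` blows up. Then `F` divides the equation of this plane,
and has degree at most one. -/
theorem eq_zero_of_hyperbolic {k : ℝ} (hL : L * L' = 1) (hF : Irreducible F)
    (hD : curvPoly F ≠ 0) (hk : axisField .hyperbolic L L' b F = C k * F) : k = 0 := by
  by_contra hk0
  obtain ⟨ε, hε, hkε⟩ : ∃ ε : ℝ, (ε = 1 ∨ ε = -1) ∧ 0 < k * ε := by
    rcases lt_or_gt_of_ne hk0 with h | h
    · exact ⟨-1, Or.inr rfl, by linarith⟩
    · exact ⟨1, Or.inl rfl, by linarith⟩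
  have hε2 : ε * ε = 1 := by rcases hε with rfl | rfl <;> norm_num
  have horb (s z r : ℝ) : rotationMatrix .hyperbolic (ε * r) *ᵥ ![s, -ε * s, z] =
      ![Real.exp (-r) * s, -ε * (Real.exp (-r) * s), z] := by
    have hc : Real.cosh (ε * r) = Real.cosh r := by
      rcases hε with rfl | rfl <;> simp
    have hs : Real.sinh (ε * r) = ε * Real.sinh r := by
      rcases hε with rfl | rfl <;> simp
    have he : Real.exp (-r) = Real.cosh r - Real.sinh r := (Real.cosh_sub_sinh r).symm
    ext i
    fin_cases i <;> simp [rotationMatrix, Matrix.mulVec, dotProduct, Fin.sum_univ_three, hc, hs]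
    · linear_combination -Real.sinh r * s * hε2 - s * he
    · linear_combination ε * s * he
  have hvan (s z : ℝ) : eval (L *ᵥ ![s, -ε * s, z] + b) F = 0 := by
    have h1 : Filter.Tendsto (fun r : ℝ => Real.exp (-(k * ε * r))) Filter.atTop (nhds 0) :=
      Real.tendsto_exp_neg_atTop_nhds_zero.comp (Filter.tendsto_id.const_mul_atTop hkε)
    have hcont : Continuous fun y : ℝ => eval (L *ᵥ ![y * s, -ε * (y * s), z] + b) F := by
      refine (contDiff_eval F).continuous.comp ?_
      refine Continuous.add (Continuous.matrix_mulVec continuous_const ?_) continuous_const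
      refine continuous_pi fun i => ?_
      fin_cases i <;> simp <;> fun_prop
    have h2 := (hcont.tendsto 0).comp Real.tendsto_exp_neg_atTop_nhds_zero
    have h3 := h1.mul h2
    rw [zero_mul] at h3
    refine tendsto_nhds_unique (tendsto_const_nhds.congr fun r => ?_) h3
    have := eval_orbit hL hk ![s, -ε * s, z] (ε * r)
    rw [horb] at this
    rw [Function.comp_apply, this, ← mul_assoc, ← Real.exp_add]
    simp [mul_assoc]
  -- The plane is parametrized by `(s, z) ↦ L (s, -ε s, z) + b`, and `G` is an affine equation of it.
  have hplane (w q : ℝ × ℝ) :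
      fderiv ℝ (fun q : ℝ × ℝ => L *ᵥ ![q.1, -ε * q.1, q.2] + b) q w =
        L *ᵥ ![w.1, -ε * w.1, w.2] := by
    let ℓ : ℝ × ℝ →ₗ[ℝ] R3 := L.mulVecLin ∘ₗ
      { toFun := fun q => ![q.1, -ε * q.1, q.2]
        map_add' := fun a b => by ext i; fin_cases i <;> simp; ring
        map_smul' := fun a b => by ext i; fin_cases i <;> simp; ring }
    have h : HasFDerivAt (fun q : ℝ × ℝ => L *ᵥ ![q.1, -ε * q.1, q.2] + b)
      ℓ.toContinuousLinearMap q := ℓ.toContinuousLinearMap.hasFDerivAt.add_const b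
    rw [h.fderiv]
    rfl
  have hdet : L.det ≠ 0 := fun h => by
    have := congrArg Matrix.det hL
    rw [Matrix.det_mul, h, zero_mul, Matrix.det_one] at this
    exact zero_ne_one this
  have hx : IsRegularPatch (fun q : ℝ × ℝ => L *ᵥ ![q.1, -ε * q.1, q.2] + b) Set.univ := by
    refine ⟨isOpen_univ, ContDiff.contDiffOn ?_, fun q _ h => ?_⟩
    · refine ContDiff.add (L.mulVecLin.toContinuousLinearMap.contDiff.comp ?_) contDiff_const
      rw [contDiff_pi]
      intro i
      fin_cases i
      · exact contDiff_fst
      · exact contDiff_const.mul contDiff_fst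
      · exact contDiff_snd
    · have h1 := dotProduct_cross_mulVec L ![0, 1, 0] ![1, -ε * 1, 0] ![0, -ε * 0, 1]
      simp only [dU, dV, hplane] at h
      rw [h, dotProduct_zero] at h1
      simp [cross_apply, hdet] at h1
  let N : Matrix (Fin 3) (Fin 3) ℝ := !![ε, 1, 0; 0, 0, 0; 0, 0, 0] * L'
  let G : Poly := affineField N (-(N *ᵥ b)) 0
  have hG (p : R3) : eval (L *ᵥ p + b) G = ε * p 0 + p 1 := by
    rw [eval_affineField, Matrix.mulVec_add, add_neg_cancel_right, Matrix.mulVec_mulVec,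
      Matrix.mul_assoc, mul_eq_one_comm.1 hL, Matrix.mul_one]
    simp [Matrix.mulVec, dotProduct, Fin.sum_univ_three]
  have hdvd : F ∣ G := by
    refine hx.dvd_of_vanish Set.univ_nonempty hF (fun q _ => hvan _ _) fun q _ => ?_
    rw [hG]
    simp
  have hG0 : G ≠ 0 := fun h => by
    have := hG ![0, 1, 0]
    rw [h] at this
    simp at this
  exact hD (curvPoly_eq_zero_of_totalDegree_le_one
    ((totalDegree_le_of_dvd_of_isDomain hdvd hG0).trans (totalDegree_affineField_le _ _ _)))

theorem axisField_eq_zero (hL : L * L' = 1) (hF : Irreducible F)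
    (hK : HasNonzeroCurvature (zeroSet F))
    (hS : ∀ t p, eval (L *ᵥ p + b) F = 0 → eval (L *ᵥ (rotationMatrix τ t *ᵥ p) + b) F = 0) :
    axisField τ L L' b F = 0 := by
  obtain ⟨k, hk⟩ := axisField_eq_C_mul hL hF hK hS
  have hk0 : k = 0 := by
    cases τ
    · exact eq_zero_of_elliptic hL hF.ne_zero hk
    · exact eq_zero_of_hyperbolic hL hF (curvPoly_ne_zero hF hK) hk
    · exact eq_zero_of_parabolic hL hF.ne_zero hk
  rw [hk, hk0, map_zero, zero_mul]

end Flow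

/-! ### Values of rational functions and the linear equation of the axis -/

theorem hasValueAt_algebraMap (p : Poly) (P : R3) :
    HasValueAt (algebraMap Poly RatFun p) P (eval P p) :=
  ⟨p, 1, by simp, by simp, by simp⟩

theorem algebraMap_ne_zero_of_eval_ne_zero {P : R3} {q : Poly} (h : eval P q ≠ 0) :
    algebraMap Poly RatFun q ≠ 0 := by
  rw [Ne, FaithfulSMul.algebraMap_eq_zero_iff]
  rintro rfl
  exact h (map_zero _)

theorem HasValueAt.add {r s : RatFun} {P : R3} {c d : ℝ} (hr : HasValueAt r P c)
    (hs : HasValueAt s P d) : HasValueAt (r + s) P (c + d) := by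
  obtain ⟨p, q, hq, rfl, rfl⟩ := hr
  obtain ⟨p', q', hq', rfl, rfl⟩ := hs
  refine ⟨p * q' + q * p', q * q', ?_, ?_, ?_⟩
  · rw [map_mul]; exact mul_ne_zero hq hq'
  · rw [div_add_div _ _ (algebraMap_ne_zero_of_eval_ne_zero hq)
      (algebraMap_ne_zero_of_eval_ne_zero hq')]
    simp only [map_add, map_mul]
  · rw [div_add_div _ _ hq hq']
    simp only [map_add, map_mul]

theorem HasValueAt.mul {r s : RatFun} {P : R3} {c d : ℝ} (hr : HasValueAt r P c)
    (hs : HasValueAt s P d) : HasValueAt (r * s) P (c * d) := by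
  obtain ⟨p, q, hq, rfl, rfl⟩ := hr
  obtain ⟨p', q', hq', rfl, rfl⟩ := hs
  refine ⟨p * p', q * q', ?_, ?_, ?_⟩
  · rw [map_mul]; exact mul_ne_zero hq hq'
  · rw [div_mul_div_comm, map_mul, map_mul]
  · rw [div_mul_div_comm, map_mul, map_mul]

theorem hasValueAt_constVec (v P : R3) (i : Fin 3) : HasValueAt (constVec v i) P (v i) := by
  have := hasValueAt_algebraMap (C (v i)) P
  rwa [eval_C, ← algebraMap_eq, ← IsScalarTower.algebraMap_apply] at this

theorem hasValueAt_genericPoint (P : R3) (i : Fin 3) : HasValueAt (genericPoint i) P (P i) := by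
  have := hasValueAt_algebraMap (X i) P
  rwa [eval_X] at this

theorem HasValueAt.neg {r : RatFun} {P : R3} {c : ℝ} (hr : HasValueAt r P c) :
    HasValueAt (-r) P (-c) := by
  have := (hasValueAt_algebraMap (C (-1)) P).mul hr
  simpa using this

theorem HasValueAt.sub {r s : RatFun} {P : R3} {c d : ℝ} (hr : HasValueAt r P c)
    (hs : HasValueAt s P d) : HasValueAt (r - s) P (c - d) := by
  rw [sub_eq_add_neg, sub_eq_add_neg]
  exact hr.add hs.neg

theorem hasValueAt_pluckerForm {γ : Fin 3 → RatFun} {P c : R3} (h : ∀ i, HasValueAt (γ i) P (c i))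
    (α β : R3) : HasValueAt (constVec α ⬝ᵥ (genericPoint ⨯₃ γ) + constVec β ⬝ᵥ γ) P
      (α ⬝ᵥ (P ⨯₃ c) + β ⬝ᵥ c) := by
  have hg := hasValueAt_genericPoint P
  have hα := hasValueAt_constVec α P
  have hβ := hasValueAt_constVec β P
  simp only [dotProduct, Fin.sum_univ_three, cross_apply, Matrix.cons_val]
  exact ((((hα 0).mul (((hg 1).mul (h 2)).sub ((hg 2).mul (h 1)))).add
    ((hα 1).mul (((hg 2).mul (h 0)).sub ((hg 0).mul (h 2))))).add
    ((hα 2).mul (((hg 0).mul (h 1)).sub ((hg 1).mul (h 0))))).add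
    ((((hβ 0).mul (h 0)).add ((hβ 1).mul (h 1))).add ((hβ 2).mul (h 2)))

theorem HasValueAt.eq_zero_of_zero {P : R3} {c : ℝ} (h : HasValueAt 0 P c) : c = 0 := by
  obtain ⟨p, q, hq, h0, rfl⟩ := h
  rcases div_eq_zero_iff.1 h0.symm with h | h
  · rw [FaithfulSMul.algebraMap_eq_zero_iff] at h
    rw [h, map_zero, zero_div]
  · exact absurd h (algebraMap_ne_zero_of_eval_ne_zero hq)

theorem eq_zero_of_hasValueAt_zero {r : RatFun} {h : Poly} (hh : h ≠ 0)
    (hr : ∀ P : R3, eval P h ≠ 0 → HasValueAt r P 0) : r = 0 := by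
  obtain ⟨p, q, hq, rfl⟩ := IsFractionRing.div_surjective (A := Poly) r
  have hq0 : algebraMap Poly RatFun q ≠ 0 := by
    rw [Ne, FaithfulSMul.algebraMap_eq_zero_iff]
    exact nonZeroDivisors.ne_zero hq
  have hp : p * h = 0 := by
    refine MvPolynomial.funext fun P => ?_
    rw [map_mul, map_zero, mul_eq_zero]
    by_cases hP : eval P h = 0
    · exact Or.inr hP
    obtain ⟨p', q', hq', h1, h2⟩ := hr P hP
    rw [div_eq_div_iff hq0 (algebraMap_ne_zero_of_eval_ne_zero hq'), ← map_mul, ← map_mul] at h1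
    have h3 := congrArg (eval P) (FaithfulSMul.algebraMap_injective Poly RatFun h1)
    rw [map_mul, map_mul, (div_eq_zero_iff.1 h2.symm).resolve_right hq', zero_mul] at h3
    exact Or.inl ((mul_eq_zero.1 h3).resolve_right hq')
  rw [(mul_eq_zero.1 hp).resolve_right hh, map_zero, zero_div]

theorem gradAt_ne_zero_of_curvPoly_ne_zero {F : Poly} {P : R3} (h : eval P (curvPoly F) ≠ 0) :
    gradAt F P ≠ 0 := by
  intro h0
  rw [eval_curvPoly, h0, curv, zero_dotProduct] at h
  exact h rfl

theorem isRationalPart_normalPoly {F : Poly} (hF : Irreducible F) :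
    IsRationalPartOfAffineNormal F fun i => algebraMap Poly RatFun (normalPoly F i) := by
  obtain ⟨i, hi⟩ := Function.ne_iff.1 (grad_ne_zero (not_exists_eq_C hF))
  refine ⟨grad F i, hi, fun P hP => ⟨fun i => eval P (normalPoly F i),
    fun i => hasValueAt_algebraMap _ P, fun x U hx hxF q hq hqP hK => ?_⟩⟩
  have hg : gradAt F (x q) ≠ 0 := fun h0 => hP (by rw [← hqP]; exact congrFun h0 i)
  rw [gaussCurvature_eq hx hxF hq hg] at hK
  obtain ⟨a, -, ha⟩ := exists_affineNormal_eq hx hxF hq hg fun h0 => hK (by rw [h0, zero_div])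
  exact ⟨a, by rw [ha, hqP]⟩

/-- If the affine normal at `P` is a multiple of `c` for every parametrization of the level surface,
then `c` is proportional to `normalPoly F`: a parametrization exists, and its affine normal is not
zero. -/
theorem exists_eq_smul_normalPoly {F : Poly} {P c : R3} (hD : eval P (curvPoly F) ≠ 0)
    (hc : ∀ (x : ℝ × ℝ → R3) (U : Set (ℝ × ℝ)), IsRegularPatch x U →
        (∀ q ∈ U, eval (x q) F = eval P F) →
        ∀ q ∈ U, x q = P → gaussCurvature x q ≠ 0 → ∃ a : ℝ, affineNormal x q = a • c) :
    ∃ a : ℝ, c = a • fun i => eval P (normalPoly F i) := by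
  have hg := gradAt_ne_zero_of_curvPoly_ne_zero hD
  obtain ⟨x, U, hx, hxF, q, hq, rfl⟩ := exists_patch_of_gradAt_ne_zero hg
  obtain ⟨a, ha⟩ := hc x U hx hxF q hq rfl (by
    rw [gaussCurvature_eq hx hxF hq hg]
    exact div_ne_zero hD (pow_ne_zero 2 (dotProduct_self_pos hg).ne'))
  obtain ⟨a', ha', h⟩ := exists_affineNormal_eq hx hxF hq hg hD
  have hN : (fun i => eval (x q) (normalPoly F i)) ≠ 0 := by
    intro h0
    have h1 := dotProduct_normalDir (gradAt F (x q)) (gradAt (curvPoly F) (x q))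
      (eval (x q) (curvPoly F)) (hessAt F (x q))
    simp only [eval_normalPoly] at h0
    rw [← eval_curvPoly] at h1
    have h2 : gradAt F (x q) ⬝ᵥ normalDir (gradAt F (x q)) (gradAt (curvPoly F) (x q))
      (eval (x q) (curvPoly F)) (hessAt F (x q)) = 0 := (congrArg _ h0).trans (dotProduct_zero _)
    rw [h2] at h1
    simp [hD] at h1
  have ha0 : a ≠ 0 := by
    rintro rfl
    rw [h, zero_smul] at ha
    exact (smul_ne_zero ha' hN) ha
  exact ⟨a⁻¹ * a', by rw [mul_smul, ← h, ha, smul_smul, inv_mul_cancel₀ ha0, one_smul]⟩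

theorem eq_smul_of_generator_mulVec_eq_zero {τ : RotationType} {p : R3}
    (h : generator τ *ᵥ p = 0) : p = p 2 • ![0, 0, 1] := by
  have h0 := congrFun h 0
  have h1 := congrFun h 1
  have h2 := congrFun h 2
  ext i
  cases τ <;> fin_cases i <;>
    simp [generator, Matrix.mulVec, dotProduct, Fin.sum_univ_three] at h0 h1 h2 ⊢ <;> assumption

/-- The affine normal at `P` is parallel to a plane that contains `P` and the axis, the line through
`b` with direction `L (0, 0, 1)`. -/
theorem axis_coplanar_normalPoly {τ : RotationType} {L L' : Matrix (Fin 3) (Fin 3) ℝ} {b : R3}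
    {F : Poly} (hL : L * L' = 1) (h : axisField τ L L' b F = 0) {P : R3}
    (hD : eval P (curvPoly F) ≠ 0) :
    (L *ᵥ ![0, 0, 1]) ⬝ᵥ ((P - b) ⨯₃ fun i => eval P (normalPoly F i)) = 0 := by
  have hA : (L * generator τ * L') *ᵥ P + -((L * generator τ * L') *ᵥ b) =
      (L * generator τ * L') *ᵥ (P - b) := by rw [Matrix.mulVec_sub, sub_eq_add_neg]
  by_cases h0 : (L * generator τ * L') *ᵥ (P - b) = 0
  · -- The point lies on the axis.
    have h1 : generator τ *ᵥ (L' *ᵥ (P - b)) = 0 := by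
      have := congrArg (L' *ᵥ ·) h0
      simp only [Matrix.mulVec_zero, Matrix.mulVec_mulVec] at this
      rwa [← Matrix.mul_assoc, ← Matrix.mul_assoc, mul_eq_one_comm.1 hL, Matrix.one_mul,
        ← Matrix.mulVec_mulVec] at this
    have h2 := congrArg (L *ᵥ ·) (eq_smul_of_generator_mulVec_eq_zero h1)
    simp only [Matrix.mulVec_mulVec, hL, Matrix.one_mulVec, Matrix.mulVec_smul] at h2
    rw [h2, map_smul, LinearMap.smul_apply, dotProduct_smul, dot_self_cross, smul_zero]
  · refine conj_generator_coplanar τ hL (g := gradAt F P) ?_ ?_ ?_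
    · exact gradAt_dotProduct_mulVec_normalPoly (trace_conj_generator hL) h hD
    · rw [← hA]
      exact gradAt_dotProduct_field h P
    · exact transpose_mulVec_gradAt_ne_zero h hD (by rwa [hA])

theorem mem_map_zAxis {T : R3 ≃ᵃ[ℝ] R3} {P : R3} (h : P ∈ zAxis.map (T : R3 →ᵃ[ℝ] R3)) :
    ∃ z : ℝ, P = T (z • ![0, 0, 1]) := by
  obtain ⟨p, hp, rfl⟩ := h
  obtain ⟨z, hz⟩ := Submodule.mem_span_singleton.1 ((AffineSubspace.mem_mk').1 hp)
  refine ⟨z, ?_⟩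
  rw [hz]
  simp

end AffineRotation
end

open AffineRotation in
theorem theorem10 (F : AffineRotation.Poly) (hF : Irreducible F)
    (hK : AffineRotation.HasNonzeroCurvature (AffineRotation.zeroSet F))
    (A : AffineSubspace ℝ AffineRotation.R3)
    (hA : AffineRotation.IsAffineRotationSurface (AffineRotation.zeroSet F) A)
    (β α : AffineRotation.R3) (hβα : AffineRotation.IsPluckerCoordinates A β α) :
    (∃ γ : Fin 3 → AffineRotation.RatFun, AffineRotation.IsRationalPartOfAffineNormal F γ) ∧
    ∀ γ : Fin 3 → AffineRotation.RatFun, AffineRotation.IsRationalPartOfAffineNormal F γ →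
      AffineRotation.constVec α ⬝ᵥ (AffineRotation.genericPoint ⨯₃ γ)
          + AffineRotation.constVec β ⬝ᵥ γ = 0 ∧
      ∀ P c : AffineRotation.R3, (∀ i, AffineRotation.HasValueAt (γ i) P (c i)) →
        α ⬝ᵥ (P ⨯₃ c) + β ⬝ᵥ c = 0 := by
  refine ⟨⟨_, isRationalPart_normalPoly hF⟩, fun γ hγ => ?_⟩
  suffices h0 : constVec α ⬝ᵥ (genericPoint ⨯₃ γ) + constVec β ⬝ᵥ γ = 0 from
    ⟨h0, fun P c hc => (h0 ▸ hasValueAt_pluckerForm hc α β).eq_zero_of_zero⟩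
  obtain ⟨T, τ, hTA, hT⟩ := hA
  obtain ⟨L, L', b, hL, hTL⟩ := exists_matrix_affineEquiv T
  have hfield : axisField τ L L' b F = 0 := axisField_eq_zero hL hF hK fun t p hp => by
    have := (hT t p).2
    simp only [hTL] at this
    exact this hp
  obtain ⟨-, Q, hAQ, rfl⟩ := hβα
  have hQ : Q ∈ A := by
    rw [hAQ]
    exact AffineSubspace.self_mem_mk' _ _
  have hQα : α + Q ∈ A := by
    rw [hAQ, AffineSubspace.mem_mk']
    simp
  rw [← hTA] at hQ hQα
  obtain ⟨z, hz⟩ := mem_map_zAxis hQ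
  obtain ⟨z', hz'⟩ := mem_map_zAxis hQα
  rw [hTL, Matrix.mulVec_smul] at hz hz'
  have hα : α = (z' - z) • (L *ᵥ ![0, 0, 1]) := by
    rw [sub_smul, eq_sub_of_add_eq hz', hz]
    abel
  obtain ⟨h, hh, hγ⟩ := hγ
  refine eq_zero_of_hasValueAt_zero (mul_ne_zero hh (curvPoly_ne_zero hF hK)) fun P hP => ?_
  rw [map_mul] at hP
  have hD := right_ne_zero_of_mul hP
  obtain ⟨c, hc, hx⟩ := hγ P (left_ne_zero_of_mul hP)
  have hval := hasValueAt_pluckerForm hc α (Q ⨯₃ α)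
  -- The left-hand side is the determinant of `α`, `P - Q` and `c`.
  suffices h0 : α ⬝ᵥ (P ⨯₃ c) + (Q ⨯₃ α) ⬝ᵥ c = 0 by rwa [h0] at hval
  obtain ⟨a, rfl⟩ := exists_eq_smul_normalPoly hD hx
  have key := axis_coplanar_normalPoly hL hfield hD
  generalize (fun i => MvPolynomial.eval P (normalPoly F i)) = N at key ⊢
  generalize L *ᵥ ![0, 0, 1] = e at *
  rw [hα, hz]
  simp [cross_apply, dotProduct, Fin.sum_univ_three] at key ⊢
  linear_combination a * (z' - z) * key
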